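/- Let $k$ be a perfect field with $\operatorname{char} k\neq 2$, and let $Sm_k$ be the category of smooth affine schemes of finite type over $k$. For $X,Y\in Sm_k$, a quadratic space from $X$ to $Y$ is a $k[X\times Y]$-module $P$ that is finitely generated projective over $k[X]$, together with a $k[X\times Y]$-linear symmetric isomorphism $q_P\colon P\to \mathrm{Hom}_{k[X]}(P,k[X])$. Let $WCor_k(X,Y)$ be the Witt group of such spaces, that is, isometry classes under orthogonal sum modulo metabolic spaces (spaces with a Lagrangian $k[X\times Y]$-submodule $L=L^{\perp}$ for which $P/L$ is projective over $k[X]$). The additive category $WCor_k$ has the objects of $Sm_k$, the groups $WCor_k(X,Y)$ as morphisms, composition given by the tensor product of quadratic spaces, and identities $(k[X],\,(a,b)\mapsto ab)$; a morphism $f\colon X\to Y$ in $Sm_k$ gives the correspondence $(k[X],\,(a,b)\mapsto ab)$, on which $k[Y]$ acts through $f^*$. Let $\mathscr F$ be a homotopy invariant sheaf with Witt-transfers: an additive functor $WCor_k^{op}\to Ab$ whose restriction to $Sm_k$ is a sheaf in the Zariski topology (in particular, any functor whose restriction is a Nisnevich sheaf is allowed), such that the projection induces an isomorphism $\mathscr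 F(X)\cong\mathscr F(X\times\mathbb A^1)$ for all $X\in Sm_k$. As a Zariski sheaf, $\mathscr F$ is also defined on open subschemes of schemes in $Sm_k$; on inverse limits of such open subschemes along open immersions it is defined as the direct limit of its values. Let $U=\mathrm{Spec}\,\mathcal O_{X,x}$, where $X$ is a smooth variety over $k$, which may be taken affine, and $x$ is any point of $X$. Let $0_U\subset\mathbb A^1_U$ be the zero section. Then, for every Zariski open $V\subset\mathbb A^1_U$ that contains $0_U$, the restriction homomorphism $$i^*\colon \frac{\mathscr F(\mathbb A^1_U-0_U)}{\mathscr F(\mathbb A^1_U)}\longrightarrow\frac{\mathscr F(V-0_U)}{\mathscr F(V)}$$ is an isomorphism, where the quotients denote cokernels of the restriction maps $\mathscr F(\mathbb A^1_U)\to\mathscr F(\mathbb A^1_U-0_U)$ and $\mathscr F(V)\to\mathscr F(V-0_U)$. -/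

import Mathlib

open CategoryTheory TopologicalSpace
open scoped TensorProduct Polynomial

universe u w

namespace WittTransfers

/-- A quadratic space in the exact category with duality `Proj (X, Y)`, `X = Spec A`, `Y = Spec B`:
a `k[X × Y]`-module `P` that is finitely generated projective over `k[X] = A`, with a `k[X × Y]`-linear
symmetric isomorphism `P ≃ Hom_A (P, A)`.  The structure of a module over `k[X × Y] = A ⊗ B` is given
by the `A`-module structure and a ring homomorphism `act` from `B` to the `A`-linear endomorphisms
of `P` that agrees with the `A`-module structure on `k`.  The form is `k[X × Y]`-linear
as a map to `Hom_A (P, A)`, on which `b : B` acts by `ρ ↦ ρ (b · _)`. -/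
structure QuadSpace (k A B : Type u) [CommRing k] [CommRing A] [CommRing B] [Algebra k A]
    [Algebra k B] : Type (u + 1) where
  carrier : Type u
  [addCommGroup : AddCommGroup carrier]
  [module : Module A carrier]
  [finite : Module.Finite A carrier]
  [projective : Module.Projective A carrier]
  act : B →+* Module.End A carrier
  act_algebraMap : ∀ (c : k) (x : carrier), act (algebraMap k B c) x = algebraMap k A c • x
  form : carrier →ₗ[A] Module.Dual A carrier
  form_symm : ∀ x y, form x y = form y x
  form_act : ∀ (b : B) (x y : carrier), form (act b x) y = form x (act b y)
  form_bijective : Function.Bijective form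

attribute [instance] QuadSpace.addCommGroup QuadSpace.module QuadSpace.finite QuadSpace.projective

/-- A criterion for a symmetric form to be perfect on a finitely generated projective module. -/
theorem perfect_of_dual {A M : Type u} [CommRing A] [AddCommGroup M] [Module A M]
    (h : M →ₗ[A] Module.Dual A M) (hs : ∀ x y, h x y = h y x) {ι : Type} [Fintype ι]
    (p q : ι → M) (H : ∀ x, ∑ i, h (p i) x • q i = x) :
    Module.Finite A M ∧ Module.Projective A M ∧ Function.Bijective h := by
  classical
  let s : M →ₗ[A] (ι → A) := LinearMap.pi fun i => h (p i)
  let r : (ι → A) →ₗ[A] M := Fintype.linearCombination A q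
  have hrs : r ∘ₗ s = LinearMap.id := by
    ext x; simpa [r, s, Fintype.linearCombination_apply] using H x
  refine ⟨Module.Finite.of_surjective r fun x => ⟨s x, LinearMap.congr_fun hrs x⟩,
    Module.Projective.of_split s r hrs, ?_, ?_⟩
  · rw [injective_iff_map_eq_zero]
    intro x hx
    rw [← H x]
    exact Finset.sum_eq_zero fun i _ => by rw [hs, hx]; simp
  · intro φ
    refine ⟨∑ i, φ (q i) • p i, ?_⟩
    ext x
    conv_rhs => rw [← H x]
    simp [mul_comm]

theorem exists_dual_of_projective {A M : Type u} [CommRing A] [AddCommGroup M] [Module A M]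
    [Module.Finite A M] [Module.Projective A M] :
    ∃ (n : ℕ) (f : Fin n → Module.Dual A M) (q : Fin n → M), ∀ x, ∑ i, f i x • q i = x := by
  obtain ⟨n, r, s, -, -, h⟩ := Module.Finite.exists_comp_eq_id_of_projective A M
  refine ⟨n, fun i => LinearMap.proj i ∘ₗ s, fun i => r (Pi.single i 1), fun x => ?_⟩
  have := LinearMap.congr_fun h x
  conv_rhs => rw [← LinearMap.id_apply (R := A) x, ← this]
  have e : s x = ∑ i, s x i • (Pi.single i 1 : Fin n → A) := by
    ext j
    simp [Finset.sum_apply, Pi.single_apply]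
  conv_rhs => rw [LinearMap.comp_apply, e, map_sum]
  simp

namespace QuadSpace

section

variable {k A B C D : Type u} [CommRing k] [CommRing A] [CommRing B] [CommRing C] [CommRing D]
  [Algebra k A] [Algebra k B] [Algebra k C] [Algebra k D]

theorem exists_dual (P : QuadSpace k A B) :
    ∃ (n : ℕ) (p q : Fin n → P.carrier), ∀ x, ∑ i, P.form (p i) x • q i = x := by
  obtain ⟨n, f, q, h⟩ := exists_dual_of_projective (A := A) (M := P.carrier)
  choose p hp using fun i => P.form_bijective.2 (f i)
  exact ⟨n, p, q, fun x => by simpa only [hp] using h x⟩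

/-- An isometry of quadratic spaces: a `k[X × Y]`-linear isomorphism that respects the forms. -/
structure Isom (P Q : QuadSpace k A B) where
  toEquiv : P.carrier ≃ₗ[A] Q.carrier
  map_act : ∀ b x, toEquiv (P.act b x) = Q.act b (toEquiv x)
  map_form : ∀ x y, Q.form (toEquiv x) (toEquiv y) = P.form x y

/-- Two spaces are isometric. -/
def Isometric (P Q : QuadSpace k A B) : Prop := Nonempty (Isom P Q)

theorem Isometric.refl (P : QuadSpace k A B) : Isometric P P :=
  ⟨⟨LinearEquiv.refl A _, fun _ _ => rfl, fun _ _ => rfl⟩⟩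

theorem Isometric.symm {P Q : QuadSpace k A B} : Isometric P Q → Isometric Q P := by
  rintro ⟨e⟩
  refine ⟨⟨e.toEquiv.symm, fun b x => ?_, fun x y => ?_⟩⟩
  · rw [LinearEquiv.symm_apply_eq, e.map_act, LinearEquiv.apply_symm_apply]
  · rw [← e.map_form, LinearEquiv.apply_symm_apply, LinearEquiv.apply_symm_apply]

theorem Isometric.trans {P Q R : QuadSpace k A B} :
    Isometric P Q → Isometric Q R → Isometric P R := by
  rintro ⟨e⟩ ⟨f⟩
  exact ⟨⟨e.toEquiv.trans f.toEquiv, fun b x => by simp [e.map_act, f.map_act],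
    fun x y => by simp [e.map_form, f.map_form]⟩⟩

/-- The orthogonal sum. -/
def sum (P Q : QuadSpace k A B) : QuadSpace k A B where
  carrier := P.carrier × Q.carrier
  act := (LinearMap.prodMapRingHom A P.carrier Q.carrier).comp (P.act.prod Q.act)
  act_algebraMap c x := by ext <;> simp [P.act_algebraMap, Q.act_algebraMap]
  form := LinearMap.mk₂ A (fun x y => P.form x.1 y.1 + Q.form x.2 y.2)
    (fun x x' y => by simp only [Prod.fst_add, Prod.snd_add, map_add, LinearMap.add_apply]; ring)
    (fun c x y => by simp [mul_add])
    (fun x y y' => by simp only [Prod.fst_add, Prod.snd_add, map_add]; ring)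
    (fun c x y => by simp [mul_add])
  form_symm x y := by simp [P.form_symm x.1, Q.form_symm x.2]
  form_act b x y := by simp [P.form_act, Q.form_act]
  form_bijective := by
    constructor
    · rw [injective_iff_map_eq_zero]
      intro x hx
      ext
      · refine (injective_iff_map_eq_zero P.form).1 P.form_bijective.1 _ ?_
        ext y
        simpa using LinearMap.congr_fun hx (y, 0)
      · refine (injective_iff_map_eq_zero Q.form).1 Q.form_bijective.1 _ ?_
        ext y
        simpa using LinearMap.congr_fun hx (0, y)
    · intro φ
      obtain ⟨x, hx⟩ := P.form_bijective.2 (φ ∘ₗ LinearMap.inl A _ _)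
      obtain ⟨y, hy⟩ := Q.form_bijective.2 (φ ∘ₗ LinearMap.inr A _ _)
      refine ⟨(x, y), ?_⟩
      ext z
      · simpa using LinearMap.congr_fun hx z
      · simpa using LinearMap.congr_fun hy z

@[simp] theorem sum_act (P Q : QuadSpace k A B) (b : B) (x : (P.sum Q).carrier) :
    (P.sum Q).act b x = (P.act b x.1, Q.act b x.2) := rfl

@[simp] theorem sum_form (P Q : QuadSpace k A B) (x y : (P.sum Q).carrier) :
    (P.sum Q).form x y = P.form x.1 y.1 + Q.form x.2 y.2 := rfl

/-- The space with the opposite form. -/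
def neg (P : QuadSpace k A B) : QuadSpace k A B where
  carrier := P.carrier
  act := P.act
  act_algebraMap := P.act_algebraMap
  form := -P.form
  form_symm x y := by simp [P.form_symm x y]
  form_act b x y := by simp [P.form_act]
  form_bijective := by
    have : ⇑(-P.form) = Neg.neg ∘ P.form := rfl
    rw [this]
    exact (Equiv.neg _).bijective.comp P.form_bijective

/-- The zero space. -/
def zero : QuadSpace k A B where
  carrier := PUnit
  act := { toFun := fun _ => 0, map_one' := by ext, map_mul' := fun _ _ => by ext,
           map_zero' := rfl, map_add' := fun _ _ => by ext }
  act_algebraMap _ _ := rfl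
  form := 0
  form_symm _ _ := rfl
  form_act _ _ _ := rfl
  form_bijective := ⟨fun _ _ _ => rfl, fun φ => ⟨0, by ext x; exact (map_zero φ).symm⟩⟩

/-- A space is metabolic if it has a Lagrangian: a `k[X × Y]`-submodule `L` with `L = L^⊥` whose
inclusion is an admissible monomorphism of the exact category `Proj (X, Y)`, which means that the
quotient by `L` is again (finitely generated) projective over `k[X]`. -/
def IsMetabolic (P : QuadSpace k A B) : Prop :=
  ∃ L : Submodule A P.carrier, (∀ b, ∀ x ∈ L, P.act b x ∈ L) ∧
    (∀ x, x ∈ L ↔ ∀ y ∈ L, P.form x y = 0) ∧ Module.Projective A (P.carrier ⧸ L)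

/-- A criterion for a space to be metabolic. -/
theorem IsMetabolic.of_dual (P : QuadSpace k A B) (L : Submodule A P.carrier)
    (hL : ∀ b, ∀ x ∈ L, P.act b x ∈ L) (hiso : ∀ x ∈ L, ∀ y ∈ L, P.form x y = 0)
    {ι : Type} [Fintype ι] (p q : ι → P.carrier) (hp : ∀ i, p i ∈ L)
    (H : ∀ x, x - ∑ i, P.form (p i) x • q i ∈ L) : P.IsMetabolic := by
  classical
  refine ⟨L, hL, fun x => ⟨fun hx y hy => hiso x hx y hy, fun hx => ?_⟩, ?_⟩
  · have := H x
    rwa [Finset.sum_eq_zero (fun i _ => by rw [P.form_symm, hx _ (hp i), zero_smul]),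
      sub_zero] at this
  · let s : (P.carrier ⧸ L) →ₗ[A] (ι → A) :=
      LinearMap.pi fun i => L.liftQ (P.form (p i)) fun x hx => hiso _ (hp i) _ hx
    let r : (ι → A) →ₗ[A] (P.carrier ⧸ L) := Fintype.linearCombination A fun i => L.mkQ (q i)
    refine Module.Projective.of_split s r ?_
    ext x
    have : L.mkQ (x - ∑ i, P.form (p i) x • q i) = 0 := by
      rw [L.mkQ_apply, Submodule.Quotient.mk_eq_zero]
      exact H x
    rw [map_sub, sub_eq_zero, map_sum] at this
    simp only [map_smul] at this
    exact this.symm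

theorem IsMetabolic.exists_dual {P : QuadSpace k A B} (h : P.IsMetabolic) :
    ∃ (L : Submodule A P.carrier), (∀ b, ∀ x ∈ L, P.act b x ∈ L) ∧
      (∀ x ∈ L, ∀ y ∈ L, P.form x y = 0) ∧ ∃ (n : ℕ) (p q : Fin n → P.carrier),
        (∀ i, p i ∈ L) ∧ ∀ x, x - ∑ i, P.form (p i) x • q i ∈ L := by
  obtain ⟨L, h1, h2, h3⟩ := h
  refine ⟨L, h1, fun x hx => (h2 x).1 hx, ?_⟩
  obtain ⟨n, f, q, h⟩ := exists_dual_of_projective (A := A) (M := P.carrier ⧸ L)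
  choose p hp using fun i => P.form_bijective.2 (f i ∘ₗ L.mkQ)
  choose q' hq' using fun i => L.mkQ_surjective (q i)
  refine ⟨n, p, q', fun i => ?_, fun x => ?_⟩
  · rw [h2]
    intro y hy
    rw [hp, LinearMap.comp_apply, L.mkQ_apply, (Submodule.Quotient.mk_eq_zero L).2 hy, map_zero]
  · rw [← Submodule.Quotient.mk_eq_zero, ← L.mkQ_apply, map_sub, sub_eq_zero, map_sum]
    simp only [map_smul, hq', hp, LinearMap.comp_apply]
    exact (h _).symm

theorem IsMetabolic.sum {P Q : QuadSpace k A B} (hP : P.IsMetabolic) (hQ : Q.IsMetabolic) :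
    (P.sum Q).IsMetabolic := by
  obtain ⟨L, h1, h2, n, p, q, h3, h4⟩ := hP.exists_dual
  obtain ⟨L', h1', h2', n', p', q', h3', h4'⟩ := hQ.exists_dual
  refine IsMetabolic.of_dual (P.sum Q) (L.prod L') (fun b x hx => ⟨h1 b _ hx.1, h1' b _ hx.2⟩)
    (fun x hx y hy => by simp [h2 _ hx.1 _ hy.1, h2' _ hx.2 _ hy.2]) (ι := Fin n ⊕ Fin n')
    (Sum.elim (fun i => (p i, 0)) fun i => (0, p' i))
    (Sum.elim (fun i => (q i, 0)) fun i => (0, q' i)) ?_ ?_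
  · rintro (i | i)
    · exact ⟨h3 i, L'.zero_mem⟩
    · exact ⟨L.zero_mem, h3' i⟩
  · intro x
    obtain ⟨x, y⟩ := x
    let v : Fin n ⊕ Fin n' → P.carrier × Q.carrier :=
      Sum.elim (fun i => (p i, 0)) fun i => (0, p' i)
    let w : Fin n ⊕ Fin n' → P.carrier × Q.carrier :=
      Sum.elim (fun i => (q i, 0)) fun i => (0, q' i)
    have e : (∑ i, (P.form (v i).1 x + Q.form (v i).2 y) • w i) =
        (∑ i, P.form (p i) x • q i, ∑ i, Q.form (p' i) y • q' i) := by
      rw [Fintype.sum_sum_type]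
      refine Prod.ext ?_ ?_
      · simp [Prod.fst_sum, v, w]
      · simp [Prod.snd_sum, v, w]
    have e' : (x, y) - (∑ i, (P.form (v i).1 x + Q.form (v i).2 y) • w i) ∈ L.prod L' := by
      rw [e]
      exact ⟨h4 x, h4' y⟩
    exact e'

theorem isMetabolic_zero : (zero : QuadSpace k A B).IsMetabolic :=
  IsMetabolic.of_dual _ ⊤ (fun _ _ _ => trivial) (fun _ _ _ _ => rfl) (ι := Empty)
    (fun _ => 0) (fun _ => 0) (fun _ => trivial) fun _ => trivial

/-- The diagonal is a Lagrangian in the sum of a space and its opposite. -/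
theorem isMetabolic_sum_neg (P : QuadSpace k A B) : (P.sum P.neg).IsMetabolic := by
  obtain ⟨n, p, q, h⟩ := P.exists_dual
  refine IsMetabolic.of_dual (P.sum P.neg)
    (LinearMap.range (LinearMap.prod (LinearMap.id : P.carrier →ₗ[A] P.carrier) LinearMap.id))
    ?_ ?_ (fun i => (p i, p i)) (fun i => (q i, 0)) (fun i => ⟨p i, rfl⟩) ?_
  · rintro b _ ⟨x, rfl⟩
    exact ⟨P.act b x, rfl⟩
  · rintro _ ⟨x, rfl⟩ _ ⟨y, rfl⟩
    change P.form x y + -P.form x y = 0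
    ring
  · intro x
    obtain ⟨x, y⟩ := x
    change P.carrier at y
    refine ⟨y, ?_⟩
    have e : ∑ i, (P.form (p i) x + -P.form (p i) y) • ((q i, 0) : P.carrier × P.carrier)
        = ((∑ i, P.form (p i) x • q i) - ∑ i, P.form (p i) y • q i, 0) := by
      refine Prod.ext ?_ ?_
      · rw [Prod.fst_sum, ← Finset.sum_sub_distrib]
        refine Finset.sum_congr rfl fun i _ => ?_
        rw [Prod.smul_fst, ← sub_eq_add_neg, sub_smul]
      · simp [Prod.snd_sum]
    have e' : (y, y) = (x, y) -
        ∑ i, (P.form (p i) x + -P.form (p i) y) • ((q i, 0) : P.carrier × P.carrier) := by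
      rw [e, h x, h y]
      simp
    exact e'

theorem Isometric.sum {P P' Q Q' : QuadSpace k A B} :
    Isometric P P' → Isometric Q Q' → Isometric (P.sum Q) (P'.sum Q') := by
  rintro ⟨e⟩ ⟨f⟩
  exact ⟨⟨e.toEquiv.prodCongr f.toEquiv, fun b x => Prod.ext (e.map_act b x.1) (f.map_act b x.2),
    fun x y => congrArg₂ (· + ·) (e.map_form x.1 y.1) (f.map_form x.2 y.2)⟩⟩

theorem isometric_sum_comm (P Q : QuadSpace k A B) : Isometric (P.sum Q) (Q.sum P) :=
  ⟨⟨LinearEquiv.prodComm A _ _, fun _ _ => rfl, fun _ _ => add_comm _ _⟩⟩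

theorem isometric_sum_assoc (P Q R : QuadSpace k A B) :
    Isometric ((P.sum Q).sum R) (P.sum (Q.sum R)) :=
  ⟨⟨LinearEquiv.prodAssoc A _ _ _, fun _ _ => rfl, fun _ _ => (add_assoc _ _ _).symm⟩⟩

theorem isometric_sum_zero (P : QuadSpace k A B) : Isometric (P.sum zero) P :=
  ⟨⟨(LinearEquiv.prodUnique : (P.carrier × PUnit.{u + 1}) ≃ₗ[A] P.carrier), fun _ _ => rfl,
    fun x y => (add_zero (P.form x.1 y.1)).symm⟩⟩

theorem isometric_sum_sum_comm (P Q R S : QuadSpace k A B) :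
    Isometric ((P.sum Q).sum (R.sum S)) ((P.sum R).sum (Q.sum S)) :=
  ⟨⟨LinearEquiv.prodProdProdComm A _ _ _ _, fun _ _ => rfl, fun _ _ => add_add_add_comm _ _ _ _⟩⟩

/-- Witt equivalence: isometry after adding metabolic spaces. -/
def WittEquiv (P Q : QuadSpace k A B) : Prop :=
  ∃ M N : QuadSpace k A B, M.IsMetabolic ∧ N.IsMetabolic ∧ Isometric (P.sum M) (Q.sum N)

theorem Isometric.wittEquiv {P Q : QuadSpace k A B} (h : Isometric P Q) : WittEquiv P Q :=
  ⟨zero, zero, isMetabolic_zero, isMetabolic_zero, h.sum (.refl _)⟩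

theorem IsMetabolic.wittEquiv {P : QuadSpace k A B} (h : P.IsMetabolic) : WittEquiv P zero :=
  ⟨zero, P, isMetabolic_zero, h, isometric_sum_comm _ _⟩

theorem WittEquiv.symm {P Q : QuadSpace k A B} : WittEquiv P Q → WittEquiv Q P := by
  rintro ⟨M, N, hM, hN, h⟩
  exact ⟨N, M, hN, hM, h.symm⟩

theorem WittEquiv.trans {P Q R : QuadSpace k A B} :
    WittEquiv P Q → WittEquiv Q R → WittEquiv P R := by
  rintro ⟨M, N, hM, hN, h⟩ ⟨M', N', hM', hN', h'⟩
  refine ⟨M.sum M', N'.sum N, hM.sum hM', hN'.sum hN, ?_⟩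
  have h1 : Isometric ((Q.sum N).sum M') ((Q.sum M').sum N) :=
    (isometric_sum_assoc _ _ _).trans
      (((Isometric.refl Q).sum (isometric_sum_comm N M')).trans (isometric_sum_assoc _ _ _).symm)
  exact (isometric_sum_assoc _ _ _).symm.trans ((h.sum (.refl M')).trans
    (h1.trans ((h'.sum (.refl N)).trans (isometric_sum_assoc _ _ _))))

theorem WittEquiv.sum {P P' Q Q' : QuadSpace k A B} :
    WittEquiv P P' → WittEquiv Q Q' → WittEquiv (P.sum Q) (P'.sum Q') := by
  rintro ⟨M, N, hM, hN, h⟩ ⟨M', N', hM', hN', h'⟩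
  exact ⟨M.sum M', N.sum N', hM.sum hM', hN.sum hN', (isometric_sum_sum_comm _ _ _ _).trans
    ((h.sum h').trans (isometric_sum_sum_comm _ _ _ _))⟩

theorem WittEquiv.neg {P Q : QuadSpace k A B} (h : WittEquiv P Q) : WittEquiv P.neg Q.neg := by
  have h0 : WittEquiv P.neg (P.neg.sum (Q.sum Q.neg)) :=
    (isometric_sum_zero _).symm.wittEquiv.trans
      ((Isometric.refl _).wittEquiv.sum (isMetabolic_sum_neg Q).wittEquiv.symm)
  have h1 : WittEquiv (P.neg.sum (Q.sum Q.neg)) ((P.sum P.neg).sum Q.neg) :=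
    ((isometric_sum_assoc _ _ _).symm.trans ((isometric_sum_comm _ _).sum (.refl _))).wittEquiv.trans
      ((h.symm.sum (Isometric.refl _).wittEquiv).sum (Isometric.refl _).wittEquiv)
  have h2 : WittEquiv ((P.sum P.neg).sum Q.neg) Q.neg :=
    ((isMetabolic_sum_neg P).wittEquiv.sum (Isometric.refl _).wittEquiv).trans
      ((isometric_sum_comm _ _).trans (isometric_sum_zero _)).wittEquiv
  exact h0.trans (h1.trans h2)

/-- Witt equivalence as a setoid. -/
instance wittSetoid (k A B : Type u) [CommRing k] [CommRing A] [CommRing B] [Algebra k A]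
    [Algebra k B] : Setoid (QuadSpace k A B) where
  r := WittEquiv
  iseqv := ⟨fun P => (Isometric.refl P).wittEquiv, WittEquiv.symm, WittEquiv.trans⟩

end

section Comp

variable {k A B C D : Type u} [CommRing k] [CommRing A] [CommRing B] [CommRing C] [CommRing D]
  [Algebra k A] [Algebra k B] [Algebra k C] [Algebra k D]

/-- The `k[Y]`-module structure of a quadratic space in `Proj (X, Y)`, where `B = k[Y]`. -/
@[reducible] def rightModule (P : QuadSpace k A B) : Module B P.carrier :=
  Module.compHom P.carrier P.act

section Tensor

attribute [local instance] rightModule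

theorem smulCommClass_right (P : QuadSpace k A B) : SMulCommClass B A P.carrier :=
  ⟨fun b a x => map_smul (P.act b) a x⟩

attribute [local instance] smulCommClass_right

/-- The tensor product `P ⊗ Q` over `k[Y]` of `P` in `Proj (X, Y)` and `Q` in `Proj (Y, Z)`. -/
def Tensor (P : QuadSpace k A B) (Q : QuadSpace k B C) : Type u := P.carrier ⊗[B] Q.carrier

variable (P : QuadSpace k A B) (Q : QuadSpace k B C)

instance : AddCommGroup (Tensor P Q) := inferInstanceAs (AddCommGroup (P.carrier ⊗[B] Q.carrier))

instance : Module A (Tensor P Q) := inferInstanceAs (Module A (P.carrier ⊗[B] Q.carrier))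

/-- The pure tensor `p ⊗ x`. -/
def tmk (p : P.carrier) (x : Q.carrier) : Tensor P Q := p ⊗ₜ[B] x

theorem tmk_add_left (p p' : P.carrier) (x : Q.carrier) :
    tmk P Q (p + p') x = tmk P Q p x + tmk P Q p' x := TensorProduct.add_tmul p p' x

theorem tmk_add_right (p : P.carrier) (x x' : Q.carrier) :
    tmk P Q p (x + x') = tmk P Q p x + tmk P Q p x' := TensorProduct.tmul_add p x x'

theorem tmk_smul_left (a : A) (p : P.carrier) (x : Q.carrier) :
    tmk P Q (a • p) x = a • tmk P Q p x := rfl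

theorem tmk_act (b : B) (p : P.carrier) (x : Q.carrier) :
    tmk P Q (P.act b p) x = tmk P Q p (b • x) := TensorProduct.smul_tmul b p x

@[elab_as_elim]
theorem tensor_induction {motive : Tensor P Q → Prop} (z : Tensor P Q)
    (zero : motive 0) (tmul : ∀ p x, motive (tmk P Q p x))
    (add : ∀ y z, motive y → motive z → motive (y + z)) : motive z :=
  TensorProduct.induction_on z zero tmul add

/-- The universal property of `P ⊗ Q`. -/
def tensorLift {M : Type u} [AddCommGroup M] [Module A M] (f : P.carrier → Q.carrier → M)
    (hl : ∀ p p' x, f (p + p') x = f p x + f p' x) (hr : ∀ p x x', f p (x + x') = f p x + f p x')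
    (ha : ∀ (a : A) p x, f (a • p) x = a • f p x) (hb : ∀ b p x, f (P.act b p) x = f p (b • x)) :
    Tensor P Q →ₗ[A] M :=
  let g : Tensor P Q →+ M := TensorProduct.liftAddHom
    (AddMonoidHom.mk' (fun p => AddMonoidHom.mk' (f p) (hr p))
      fun p p' => AddMonoidHom.ext (hl p p')) hb
  { toFun := g
    map_add' := g.map_add
    map_smul' := fun a z => tensor_induction P Q z
      (by rw [smul_zero, map_zero, smul_zero])
      (fun p x => ha a p x) fun y z hy hz => by
        rw [smul_add, map_add, hy, hz, map_add, smul_add] }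

@[simp] theorem tensorLift_tmk {M : Type u} [AddCommGroup M] [Module A M]
    (f : P.carrier → Q.carrier → M) (hl hr ha hb) (p : P.carrier) (x : Q.carrier) :
    tensorLift P Q f hl hr ha hb (tmk P Q p x) = f p x := rfl

end Tensor

variable (P : QuadSpace k A B) (Q : QuadSpace k B C)

theorem tmk_zero_right (p : P.carrier) : tmk P Q p 0 = 0 :=
  (AddMonoidHom.mk' _ (tmk_add_right P Q p)).map_zero

theorem tmk_zero_left (x : Q.carrier) : tmk P Q 0 x = 0 :=
  (AddMonoidHom.mk' (fun p => tmk P Q p x) fun p p' => tmk_add_left P Q p p' x).map_zero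

theorem tmk_sub_right (p : P.carrier) (x x' : Q.carrier) :
    tmk P Q p (x - x') = tmk P Q p x - tmk P Q p x' :=
  (AddMonoidHom.mk' _ (tmk_add_right P Q p)).map_sub x x'

theorem tmk_sub_left (p p' : P.carrier) (x : Q.carrier) :
    tmk P Q (p - p') x = tmk P Q p x - tmk P Q p' x :=
  (AddMonoidHom.mk' (fun p => tmk P Q p x) fun p p' => tmk_add_left P Q p p' x).map_sub p p'

theorem tmk_sum_right {ι : Type} (s : Finset ι) (p : P.carrier) (x : ι → Q.carrier) :
    tmk P Q p (∑ i ∈ s, x i) = ∑ i ∈ s, tmk P Q p (x i) :=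
  map_sum (AddMonoidHom.mk' _ (tmk_add_right P Q p)) x s

theorem tmk_sum_left {ι : Type} (s : Finset ι) (p : ι → P.carrier) (x : Q.carrier) :
    tmk P Q (∑ i ∈ s, p i) x = ∑ i ∈ s, tmk P Q (p i) x :=
  map_sum (AddMonoidHom.mk' (fun p => tmk P Q p x) fun p p' => tmk_add_left P Q p p' x) p s

theorem tensor_ext {P : QuadSpace k A B} {Q : QuadSpace k B C} {M : Type u} [AddCommGroup M]
    [Module A M] {f g : Tensor P Q →ₗ[A] M}
    (h : ∀ p x, f (tmk P Q p x) = g (tmk P Q p x)) : f = g :=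
  LinearMap.ext fun z => tensor_induction P Q z (by rw [map_zero, map_zero]) h
    fun y z hy hz => by rw [map_add, map_add, hy, hz]

/-- The form on `P ⊗ Q`, given by `(p ⊗ x, p' ⊗ x') ↦ q_P (p, q_Q (x, x') p')`. -/
def tensorForm : Tensor P Q →ₗ[A] Module.Dual A (Tensor P Q) :=
  tensorLift P Q (fun p x => tensorLift P Q (fun p' x' => P.form p (P.act (Q.form x x') p'))
      (fun p' r' x' => by simp only [map_add])
      (fun p' x' y' => by simp only [map_add, LinearMap.add_apply])
      (fun a p' x' => by simp only [map_smul])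
      fun b p' x' => by
        rw [map_smul, smul_eq_mul, mul_comm, map_mul, Module.End.mul_apply])
    (fun p p' x => tensor_ext fun r y => by simp)
    (fun p x x' => tensor_ext fun r y => by simp)
    (fun a p x => tensor_ext fun r y => by simp)
    fun b p x => tensor_ext fun r y => by
      rw [tensorLift_tmk, tensorLift_tmk, P.form_act, map_smul, LinearMap.smul_apply, smul_eq_mul,
        map_mul, Module.End.mul_apply]

theorem tensorForm_tmk (p p' : P.carrier) (x x' : Q.carrier) :
    tensorForm P Q (tmk P Q p x) (tmk P Q p' x') = P.form p (P.act (Q.form x x') p') := rfl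

/-- A `k[Y]`-linear map `Q → Q'` induces `P ⊗ Q → P ⊗ Q'`. -/
def tensorMapRight {Q' : QuadSpace k B D} (f : Q.carrier →ₗ[B] Q'.carrier) :
    Tensor P Q →ₗ[A] Tensor P Q' :=
  tensorLift P Q (fun p x => tmk P Q' p (f x))
    (fun p p' x => tmk_add_left _ _ _ _ _)
    (fun p x x' => by rw [map_add, tmk_add_right])
    (fun a p x => tmk_smul_left _ _ _ _ _)
    fun b p x => by rw [tmk_act, map_smul]

@[simp] theorem tensorMapRight_tmk {Q' : QuadSpace k B D} (f : Q.carrier →ₗ[B] Q'.carrier)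
    (p : P.carrier) (x : Q.carrier) : tensorMapRight P Q f (tmk P Q p x) = tmk P Q' p (f x) := rfl

/-- The action of `k[Z]` on `P ⊗ Q` through the second factor. -/
def tensorAct : C →+* Module.End A (Tensor P Q) where
  toFun c := tensorMapRight P Q (Q.act c)
  map_one' := tensor_ext fun p x => by simp
  map_mul' c d := tensor_ext fun p x => by simp
  map_zero' := tensor_ext fun p x => by simp [tmk_zero_right]
  map_add' c d := tensor_ext fun p x => by simp [tmk_add_right]

theorem tensorAct_tmk (c : C) (p : P.carrier) (x : Q.carrier) :
    tensorAct P Q c (tmk P Q p x) = tmk P Q p (Q.act c x) := rfl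

theorem tensorForm_symm (y z : Tensor P Q) : tensorForm P Q y z = tensorForm P Q z y := by
  refine LinearMap.congr_fun (f := tensorForm P Q y) (g := (tensorForm P Q).flip y) ?_ z
  refine tensor_ext fun p' x' => ?_
  refine LinearMap.congr_fun (f := (tensorForm P Q).flip (tmk P Q p' x'))
    (g := tensorForm P Q (tmk P Q p' x')) ?_ y
  refine tensor_ext fun p x => ?_
  rw [LinearMap.flip_apply, tensorForm_tmk, tensorForm_tmk, ← P.form_act, P.form_symm, Q.form_symm]

theorem tensorForm_act (c : C) (y z : Tensor P Q) :
    tensorForm P Q (tensorAct P Q c y) z = tensorForm P Q y (tensorAct P Q c z) := by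
  refine LinearMap.congr_fun (f := tensorForm P Q (tensorAct P Q c y))
    (g := tensorForm P Q y ∘ₗ tensorAct P Q c) ?_ z
  refine tensor_ext fun p' x' => ?_
  refine LinearMap.congr_fun (f := (tensorForm P Q).flip (tmk P Q p' x') ∘ₗ tensorAct P Q c)
    (g := (tensorForm P Q).flip (tensorAct P Q c (tmk P Q p' x'))) ?_ y
  refine tensor_ext fun p x => ?_
  simp only [LinearMap.comp_apply, LinearMap.flip_apply, tensorAct_tmk, tensorForm_tmk, Q.form_act]

theorem sum_prod_tensor {m n : ℕ} (p q : Fin m → P.carrier) (p' q' : Fin n → Q.carrier)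
    (y : P.carrier) (x : Q.carrier) :
    ∑ ij : Fin m × Fin n, tensorForm P Q (tmk P Q (p ij.1) (p' ij.2)) (tmk P Q y x) •
        tmk P Q (q ij.1) (q' ij.2) =
      ∑ j, tmk P Q (∑ i, P.form (p i) (P.act (Q.form (p' j) x) y) • q i) (q' j) := by
  rw [Fintype.sum_prod_type_right]
  refine Finset.sum_congr rfl fun j _ => ?_
  rw [tmk_sum_left]
  rfl

theorem sum_tmk_act {n : ℕ} (p' q' : Fin n → Q.carrier) (y : P.carrier) (x : Q.carrier) :
    ∑ j, tmk P Q (P.act (Q.form (p' j) x) y) (q' j) = tmk P Q y (∑ j, Q.form (p' j) x • q' j) := by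
  rw [tmk_sum_right]
  exact Finset.sum_congr rfl fun j _ => tmk_act P Q _ _ _

theorem tensor_dual {m n : ℕ} {p q : Fin m → P.carrier}
    (hP : ∀ x, ∑ i, P.form (p i) x • q i = x) {p' q' : Fin n → Q.carrier}
    (hQ : ∀ x, ∑ i, Q.form (p' i) x • q' i = x) (z : Tensor P Q) :
    ∑ ij : Fin m × Fin n, tensorForm P Q (tmk P Q (p ij.1) (p' ij.2)) z •
      tmk P Q (q ij.1) (q' ij.2) = z := by
  refine tensor_induction P Q z (by simp) (fun y x => ?_) fun y z hy hz => ?_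
  · rw [sum_prod_tensor]
    simp only [hP]
    rw [sum_tmk_act, hQ]
  · simp only [map_add, add_smul, Finset.sum_add_distrib]
    rw [hy, hz]

theorem tensor_perfect : Module.Finite A (Tensor P Q) ∧ Module.Projective A (Tensor P Q) ∧
    Function.Bijective (tensorForm P Q) := by
  obtain ⟨m, p, q, hP⟩ := P.exists_dual
  obtain ⟨n, p', q', hQ⟩ := Q.exists_dual
  exact perfect_of_dual (tensorForm P Q) (tensorForm_symm P Q) _ _ (tensor_dual P Q hP hQ)

/-- The composition of quadratic spaces, given by the tensor product over `k[Y]`. -/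
def comp : QuadSpace k A C where
  carrier := Tensor P Q
  finite := (tensor_perfect P Q).1
  projective := (tensor_perfect P Q).2.1
  act := tensorAct P Q
  act_algebraMap c z := by
    refine LinearMap.congr_fun (f := tensorAct P Q (algebraMap k C c))
      (g := algebraMap k A c • LinearMap.id) (tensor_ext fun p x => ?_) z
    rw [tensorAct_tmk, Q.act_algebraMap, ← tmk_act, P.act_algebraMap, tmk_smul_left]
    rfl
  form := tensorForm P Q
  form_symm := tensorForm_symm P Q
  form_act := tensorForm_act P Q
  form_bijective := (tensor_perfect P Q).2.2

/-- The quadratic space of the graph of a morphism `X → Y`, given by `φ : k[Y] → k[X]`: the module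
`k[X]` on which `k[Y]` acts through `φ`, with the form `(x, y) ↦ x y`. -/
def graph (φ : B →ₐ[k] A) : QuadSpace k A B where
  carrier := A
  act := (Algebra.lmul A A : A →+* Module.End A A).comp (φ : B →+* A)
  act_algebraMap c x := by simp
  form := LinearMap.mul A A
  form_symm x y := mul_comm x y
  form_act b x y := by simp [mul_left_comm, mul_assoc]
  form_bijective := by
    constructor
    · intro x y h
      simpa using LinearMap.congr_fun h 1
    · intro φ
      refine ⟨φ 1, LinearMap.ext_ring ?_⟩
      simp

@[simp] theorem graph_act (φ : B →ₐ[k] A) (b : B) (x : A) : (graph φ).act b x = φ b * x := rfl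

@[simp] theorem graph_form (φ : B →ₐ[k] A) (x y : A) : (graph φ).form x y = x * y := rfl

/-- A surjective `k[X × Y]`-linear map that respects the forms is an isometry. -/
theorem Isometric.of_surjective {P Q : QuadSpace k A B} (f : P.carrier →ₗ[A] Q.carrier)
    (hact : ∀ b x, f (P.act b x) = Q.act b (f x)) (hform : ∀ x y, Q.form (f x) (f y) = P.form x y)
    (hf : Function.Surjective f) : Isometric P Q := by
  refine ⟨⟨LinearEquiv.ofBijective f ⟨?_, hf⟩, hact, hform⟩⟩
  rw [injective_iff_map_eq_zero]
  intro x hx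
  refine (injective_iff_map_eq_zero P.form).1 P.form_bijective.1 x (LinearMap.ext fun y => ?_)
  rw [← hform, hx, map_zero]
  rfl

/-- To check that a map out of `P ⊗ Q` respects structure it is enough to look at pure tensors. -/
theorem Isometric.of_tensor {P : QuadSpace k A B} {Q : QuadSpace k B C} {R : QuadSpace k A C}
    (f : Tensor P Q →ₗ[A] R.carrier)
    (hact : ∀ c p x, f (tmk P Q p (Q.act c x)) = R.act c (f (tmk P Q p x)))
    (hform : ∀ p x p' x', R.form (f (tmk P Q p x)) (f (tmk P Q p' x')) =
      P.form p (P.act (Q.form x x') p'))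
    (hf : Function.Surjective f) : Isometric (comp P Q) R := by
  refine Isometric.of_surjective (P := comp P Q) f (fun c z => ?_) (fun y z => ?_) hf
  · exact LinearMap.congr_fun (f := f ∘ₗ tensorAct P Q c) (g := R.act c ∘ₗ f)
      (tensor_ext (hact c)) z
  · refine LinearMap.congr_fun (f := R.form (f y) ∘ₗ f) (g := tensorForm P Q y)
      (tensor_ext fun p' x' => ?_) z
    exact LinearMap.congr_fun (f := R.form.flip (f (tmk P Q p' x')) ∘ₗ f)
      (g := (tensorForm P Q).flip (tmk P Q p' x')) (tensor_ext fun p x => hform p x p' x') y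

theorem comp_isometric {P P' : QuadSpace k A B} {Q Q' : QuadSpace k B C} :
    Isometric P P' → Isometric Q Q' → Isometric (comp P Q) (comp P' Q') := by
  rintro ⟨e⟩ ⟨f⟩
  let g : Tensor P Q →ₗ[A] Tensor P' Q' :=
    tensorLift P Q (fun p x => tmk P' Q' (e.toEquiv p) (f.toEquiv x))
      (fun p p' x => by rw [map_add, tmk_add_left]) (fun p x x' => by rw [map_add, tmk_add_right])
      (fun a p x => by rw [map_smul, tmk_smul_left])
      fun b p x => by rw [e.map_act, tmk_act, map_smul]
  refine Isometric.of_tensor (R := comp P' Q') g (fun c p x => ?_) (fun p x p' x' => ?_) ?_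
  · exact congrArg (tmk P' Q' (e.toEquiv p)) (f.map_act c x)
  · change P'.form (e.toEquiv p) (P'.act (Q'.form (f.toEquiv x) (f.toEquiv x')) (e.toEquiv p')) = _
    rw [f.map_form, ← e.map_act, e.map_form]
  · intro z
    refine tensor_induction P' Q' z ⟨0, map_zero g⟩ (fun p x => ?_) fun y z => ?_
    · refine ⟨tmk P Q (e.toEquiv.symm p) (f.toEquiv.symm x), ?_⟩
      change tmk P' Q' _ _ = _
      rw [LinearEquiv.apply_symm_apply, LinearEquiv.apply_symm_apply]
    · rintro ⟨y, rfl⟩ ⟨z, rfl⟩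
      exact ⟨y + z, map_add g y z⟩

theorem comp_sum_left (P P' : QuadSpace k A B) (Q : QuadSpace k B C) :
    Isometric (comp (P.sum P') Q) ((comp P Q).sum (comp P' Q)) := by
  let g : Tensor (P.sum P') Q →ₗ[A] (Tensor P Q × Tensor P' Q) :=
    tensorLift (P.sum P') Q (fun p x => (tmk P Q p.1 x, tmk P' Q p.2 x))
      (fun p p' x => Prod.ext (tmk_add_left _ _ _ _ _) (tmk_add_left _ _ _ _ _))
      (fun p x x' => Prod.ext (tmk_add_right _ _ _ _ _) (tmk_add_right _ _ _ _ _))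
      (fun a p x => Prod.ext (tmk_smul_left _ _ _ _ _) (tmk_smul_left _ _ _ _ _))
      fun b p x => Prod.ext (tmk_act _ _ _ _ _) (tmk_act _ _ _ _ _)
  have hg : ∀ p p' x, g (tmk (P.sum P') Q (p, p') x) = (tmk P Q p x, tmk P' Q p' x) :=
    fun _ _ _ => rfl
  have h1 : ∀ y : Tensor P Q, ∃ w, g w = (y, 0) := fun y => by
    refine tensor_induction P Q y ⟨0, map_zero g⟩ (fun p x => ?_) fun y z => ?_
    · exact ⟨tmk (P.sum P') Q (p, 0) x, (hg p 0 x).trans (Prod.ext rfl (tmk_zero_left P' Q x))⟩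
    · rintro ⟨y', h⟩ ⟨z', h'⟩
      exact ⟨y' + z', by rw [map_add, h, h', Prod.mk_add_mk, add_zero]⟩
  have h2 : ∀ z : Tensor P' Q, ∃ w, g w = (0, z) := fun z => by
    refine tensor_induction P' Q z ⟨0, map_zero g⟩ (fun p x => ?_) fun y z => ?_
    · exact ⟨tmk (P.sum P') Q (0, p) x, (hg 0 p x).trans (Prod.ext (tmk_zero_left P Q x) rfl)⟩
    · rintro ⟨y', h⟩ ⟨z', h'⟩
      exact ⟨y' + z', by rw [map_add, h, h', Prod.mk_add_mk, add_zero]⟩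
  have h3 : Function.Surjective g := by
    rintro ⟨y, z⟩
    obtain ⟨w, hw⟩ := h1 y
    obtain ⟨w', hw'⟩ := h2 z
    exact ⟨w + w', by rw [map_add, hw, hw', Prod.mk_add_mk, add_zero, zero_add]⟩
  exact Isometric.of_tensor (R := (comp P Q).sum (comp P' Q)) g (fun c p x => rfl)
    (fun p x p' x' => rfl) h3

theorem comp_sum_right (P : QuadSpace k A B) (Q Q' : QuadSpace k B C) :
    Isometric (comp P (Q.sum Q')) ((comp P Q).sum (comp P Q')) := by
  let g : Tensor P (Q.sum Q') →ₗ[A] (Tensor P Q × Tensor P Q') :=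
    tensorLift P (Q.sum Q') (fun p x => (tmk P Q p x.1, tmk P Q' p x.2))
      (fun p p' x => Prod.ext (tmk_add_left _ _ _ _ _) (tmk_add_left _ _ _ _ _))
      (fun p x x' => Prod.ext (tmk_add_right _ _ _ _ _) (tmk_add_right _ _ _ _ _))
      (fun a p x => Prod.ext (tmk_smul_left _ _ _ _ _) (tmk_smul_left _ _ _ _ _))
      fun b p x => Prod.ext (tmk_act _ _ _ _ _) (tmk_act _ _ _ _ _)
  have hg : ∀ p x x', g (tmk P (Q.sum Q') p (x, x')) = (tmk P Q p x, tmk P Q' p x') :=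
    fun _ _ _ => rfl
  have h1 : ∀ y : Tensor P Q, ∃ w, g w = (y, 0) := fun y => by
    refine tensor_induction P Q y ⟨0, map_zero g⟩ (fun p x => ?_) fun y z => ?_
    · exact ⟨tmk P (Q.sum Q') p (x, 0), (hg p x 0).trans (Prod.ext rfl (tmk_zero_right P Q' p))⟩
    · rintro ⟨y', h⟩ ⟨z', h'⟩
      exact ⟨y' + z', by rw [map_add, h, h', Prod.mk_add_mk, add_zero]⟩
  have h2 : ∀ z : Tensor P Q', ∃ w, g w = (0, z) := fun z => by
    refine tensor_induction P Q' z ⟨0, map_zero g⟩ (fun p x => ?_) fun y z => ?_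
    · exact ⟨tmk P (Q.sum Q') p (0, x), (hg p 0 x).trans (Prod.ext (tmk_zero_right P Q p) rfl)⟩
    · rintro ⟨y', h⟩ ⟨z', h'⟩
      exact ⟨y' + z', by rw [map_add, h, h', Prod.mk_add_mk, add_zero]⟩
  have h3 : Function.Surjective g := by
    rintro ⟨y, z⟩
    obtain ⟨w, hw⟩ := h1 y
    obtain ⟨w', hw'⟩ := h2 z
    exact ⟨w + w', by rw [map_add, hw, hw', Prod.mk_add_mk, add_zero, zero_add]⟩
  refine Isometric.of_tensor (R := (comp P Q).sum (comp P Q')) g (fun c p x => rfl)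
    (fun p x p' x' => ?_) h3
  change P.form p (P.act (Q.form x.1 x'.1) p') + P.form p (P.act (Q'.form x.2 x'.2) p') = _
  rw [sum_form, map_add, LinearMap.add_apply, map_add]

theorem comp_assoc (P : QuadSpace k A B) (Q : QuadSpace k B C) (R : QuadSpace k C D) :
    Isometric (comp (comp P Q) R) (comp P (comp Q R)) := by
  let h (r : R.carrier) : Q.carrier →ₗ[B] Tensor Q R :=
    { toFun := fun x => tmk Q R x r
      map_add' := fun x y => tmk_add_left Q R x y r
      map_smul' := fun b x => tmk_smul_left Q R b x r }
  let h' (r : R.carrier) : Tensor P Q →ₗ[A] Tensor P (comp Q R) :=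
    tensorMapRight P Q (Q' := comp Q R) (h r)
  have hh : ∀ p x r, h' r (tmk P Q p x) = tmk P (comp Q R) p (tmk Q R x r) := fun _ _ _ => rfl
  let g : Tensor (comp P Q) R →ₗ[A] Tensor P (comp Q R) :=
    tensorLift (comp P Q) R (fun z r => h' r z)
      (fun y z r => map_add (h' r) y z)
      (fun z r s => LinearMap.congr_fun (f := h' (r + s)) (g := h' r + h' s)
        (tensor_ext fun p x => by
          rw [LinearMap.add_apply, hh, hh, hh, tmk_add_right]
          exact tmk_add_right P (comp Q R) _ _ _) z)
      (fun a z r => map_smul (h' r) a z)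
      fun c z r => LinearMap.congr_fun (f := h' r ∘ₗ tensorAct P Q c) (g := h' (c • r))
        (tensor_ext fun p x => by
          rw [LinearMap.comp_apply, tensorAct_tmk, hh, hh, tmk_act]) z
  have hg : ∀ p x r, g (tmk (comp P Q) R (tmk P Q p x) r) =
    tmk P (comp Q R) p (tmk Q R x r) := fun _ _ _ => rfl
  have h2 : ∀ (p : P.carrier) (v : Tensor Q R), ∃ w, g w = tmk P (comp Q R) p v := fun p v => by
    refine tensor_induction Q R v ⟨0, ?_⟩ (fun x r => ⟨_, hg p x r⟩) fun y z => ?_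
    · exact (map_zero g).trans (tmk_zero_right P (comp Q R) p).symm
    · rintro ⟨y', e⟩ ⟨z', e'⟩
      exact ⟨y' + z', (map_add g y' z').trans ((congrArg₂ (· + ·) e e').trans
        (tmk_add_right P (comp Q R) p y z).symm)⟩
  have h3 : Function.Surjective g := fun w => by
    refine tensor_induction P (comp Q R) w ⟨0, map_zero g⟩ h2 fun y z => ?_
    rintro ⟨y, rfl⟩ ⟨z, rfl⟩
    exact ⟨y + z, map_add g y z⟩
  refine Isometric.of_tensor (R := comp P (comp Q R)) g (fun d z r => ?_)
    (fun y r z s => ?_) ?_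
  · refine LinearMap.congr_fun (f := h' (R.act d r)) (g := tensorAct P (comp Q R) d ∘ₗ h' r)
      (tensor_ext fun p x => rfl) z
  · change tensorForm P (comp Q R) (h' r y) (h' s z) =
      tensorForm P Q y (tensorAct P Q (R.form r s) z)
    refine LinearMap.congr_fun (f := tensorForm P (comp Q R) (h' r y) ∘ₗ h' s)
      (g := tensorForm P Q y ∘ₗ tensorAct P Q (R.form r s)) (tensor_ext fun p' x' => ?_) z
    exact LinearMap.congr_fun
      (f := (tensorForm P (comp Q R)).flip (h' s (tmk P Q p' x')) ∘ₗ h' r)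
      (g := (tensorForm P Q).flip (tensorAct P Q (R.form r s) (tmk P Q p' x')))
      (tensor_ext fun p x => rfl) y
  · exact h3

theorem graph_comp (Q : QuadSpace k A B) : Isometric (comp (graph (AlgHom.id k A)) Q) Q := by
  let g : Tensor (graph (AlgHom.id k A)) Q →ₗ[A] Q.carrier :=
    tensorLift (graph (AlgHom.id k A)) Q (fun (a : A) x => a • x)
      (fun p p' x => add_smul (R := A) p p' x) (fun p x x' => smul_add (M := A) p x x')
      (fun a p x => mul_smul (α := A) a p x)
      fun (b p : A) x => show (b * p) • x = p • b • x by rw [mul_comm, mul_smul]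
  have hg : ∀ (a : A) x, g (tmk (graph (AlgHom.id k A)) Q a x) = a • x := fun _ _ => rfl
  have hact : ∀ c (p : A) x, p • Q.act c x = Q.act c (p • x) := fun c p x => (map_smul _ p x).symm
  have hform : ∀ (p : A) x (p' : A) x', Q.form (p • x) (p' • x') = p * (Q.form x x' * p') := by
    intro p x p' x'
    rw [map_smul, map_smul, LinearMap.smul_apply, smul_eq_mul, smul_eq_mul]
    ring
  exact Isometric.of_tensor g hact hform fun x => ⟨tmk (graph (AlgHom.id k A)) Q (1 : A) x,
    (hg 1 x).trans (one_smul A x)⟩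

theorem comp_graph (P : QuadSpace k A B) : Isometric (comp P (graph (AlgHom.id k B))) P := by
  let g : Tensor P (graph (AlgHom.id k B)) →ₗ[A] P.carrier :=
    tensorLift P (graph (AlgHom.id k B)) (fun p (b : B) => P.act b p)
      (fun p p' x => map_add _ p p')
      (fun p (x x' : B) => show P.act (x + x') p = P.act x p + P.act x' p by
        rw [map_add, LinearMap.add_apply])
      (fun a p x => map_smul _ a p)
      fun (b : B) p (x : B) => show P.act x (P.act b p) = P.act (b * x) p by
        rw [mul_comm, map_mul, Module.End.mul_apply]
  have hg : ∀ p (b : B), g (tmk P (graph (AlgHom.id k B)) p b) = P.act b p := fun _ _ => rfl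
  have hact : ∀ (c : B) p (x : B), P.act (c * x) p = P.act c (P.act x p) := fun c p x => by
    rw [map_mul, Module.End.mul_apply]
  have hform : ∀ p (x : B) p' (x' : B), P.form (P.act x p) (P.act x' p') =
      P.form p (P.act (x * x') p') := fun p x p' x' => by
    rw [P.form_act, map_mul, Module.End.mul_apply]
  exact Isometric.of_tensor g hact hform fun p => ⟨tmk P (graph (AlgHom.id k B)) p (1 : B),
    (hg p 1).trans (by rw [map_one, Module.End.one_apply])⟩

theorem IsMetabolic.of_gen (P : QuadSpace k A B) (S : Set P.carrier)
    (hS : ∀ b, ∀ x ∈ S, P.act b x ∈ S) (hiso : ∀ x ∈ S, ∀ y ∈ S, P.form x y = 0)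
    {ι : Type} [Fintype ι] (p q : ι → P.carrier) (hp : ∀ i, p i ∈ S)
    (H : ∀ x, x - ∑ i, P.form (p i) x • q i ∈ Submodule.span A S) : P.IsMetabolic := by
  refine IsMetabolic.of_dual P (Submodule.span A S) (fun b x hx => ?_) (fun x hx y hy => ?_) p q
    (fun i => Submodule.subset_span (hp i)) H
  · have : Submodule.span A S ≤ (Submodule.span A S).comap (P.act b) :=
      Submodule.span_le.2 fun x hx => Submodule.subset_span (hS b x hx)
    exact this hx
  · have h1 : ∀ x ∈ S, Submodule.span A S ≤ LinearMap.ker (P.form x) := fun x hx =>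
      Submodule.span_le.2 fun y hy => hiso x hx y hy
    have h2 : Submodule.span A S ≤ LinearMap.ker (P.form.flip y) :=
      Submodule.span_le.2 fun x hx => h1 x hx hy
    exact h2 hx

theorem IsMetabolic.comp_left {P : QuadSpace k A B} (hP : P.IsMetabolic) (Q : QuadSpace k B C) :
    (comp P Q).IsMetabolic := by
  obtain ⟨L, h1, h2, m, p, q, h3, h4⟩ := hP.exists_dual
  obtain ⟨n, p', q', hQ⟩ := Q.exists_dual
  refine IsMetabolic.of_gen (comp P Q) {z | ∃ l ∈ L, ∃ x, z = tmk P Q l x} ?_ ?_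
    (ι := Fin m × Fin n) (fun ij => tmk P Q (p ij.1) (p' ij.2))
    (fun ij => tmk P Q (q ij.1) (q' ij.2)) (fun ij => ⟨_, h3 _, _, rfl⟩) fun (z : Tensor P Q) => ?_
  · rintro c _ ⟨l, hl, x, rfl⟩
    exact ⟨l, hl, Q.act c x, rfl⟩
  · rintro _ ⟨l, hl, x, rfl⟩ _ ⟨l', hl', x', rfl⟩
    exact h2 _ hl _ (h1 _ _ hl')
  · set M := Submodule.span A {z : Tensor P Q | ∃ l ∈ L, ∃ x, z = tmk P Q l x}
    change z - ∑ ij : Fin m × Fin n, tensorForm P Q (tmk P Q (p ij.1) (p' ij.2)) z •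
      tmk P Q (q ij.1) (q' ij.2) ∈ M
    refine tensor_induction P Q z ?_ (fun y x => ?_) fun y z hy hz => ?_
    · simp
    · rw [sum_prod_tensor]
      have e : tmk P Q y x = ∑ j, tmk P Q (P.act (Q.form (p' j) x) y) (q' j) := by
        rw [sum_tmk_act, hQ]
      rw [e, ← Finset.sum_sub_distrib]
      refine Submodule.sum_mem _ fun j _ => ?_
      rw [← tmk_sub_left]
      exact Submodule.subset_span ⟨_, h4 _, _, rfl⟩
    · simp only [map_add, add_smul, Finset.sum_add_distrib]
      rw [add_sub_add_comm]
      exact M.add_mem hy hz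

theorem IsMetabolic.comp_right (P : QuadSpace k A B) {Q : QuadSpace k B C} (hQ : Q.IsMetabolic) :
    (comp P Q).IsMetabolic := by
  obtain ⟨L, h1, h2, n, p', q', h3, h4⟩ := hQ.exists_dual
  obtain ⟨m, p, q, hP⟩ := P.exists_dual
  refine IsMetabolic.of_gen (comp P Q) {z | ∃ x, ∃ l ∈ L, z = tmk P Q x l} ?_ ?_
    (ι := Fin m × Fin n) (fun ij => tmk P Q (p ij.1) (p' ij.2))
    (fun ij => tmk P Q (q ij.1) (q' ij.2)) (fun ij => ⟨_, _, h3 _, rfl⟩) fun (z : Tensor P Q) => ?_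
  · rintro c _ ⟨x, l, hl, rfl⟩
    exact ⟨x, Q.act c l, h1 _ _ hl, rfl⟩
  · rintro _ ⟨x, l, hl, rfl⟩ _ ⟨x', l', hl', rfl⟩
    change P.form x (P.act (Q.form l l') x') = 0
    rw [h2 _ hl _ hl', map_zero, LinearMap.zero_apply, map_zero]
  · set M := Submodule.span A {z : Tensor P Q | ∃ x, ∃ l ∈ L, z = tmk P Q x l}
    change z - ∑ ij : Fin m × Fin n, tensorForm P Q (tmk P Q (p ij.1) (p' ij.2)) z •
      tmk P Q (q ij.1) (q' ij.2) ∈ M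
    refine tensor_induction P Q z ?_ (fun y x => ?_) fun y z hy hz => ?_
    · simp
    · rw [sum_prod_tensor]
      simp only [hP]
      rw [sum_tmk_act, ← tmk_sub_right]
      exact Submodule.subset_span ⟨_, _, h4 _, rfl⟩
    · simp only [map_add, add_smul, Finset.sum_add_distrib]
      rw [add_sub_add_comm]
      exact M.add_mem hy hz

theorem sum_metabolic_wittEquiv (P : QuadSpace k A B) {M : QuadSpace k A B} (hM : M.IsMetabolic) :
    WittEquiv (P.sum M) P :=
  ((Isometric.refl P).wittEquiv.sum hM.wittEquiv).trans (isometric_sum_zero P).wittEquiv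

theorem comp_wittEquiv {P P' : QuadSpace k A B} {Q Q' : QuadSpace k B C} :
    WittEquiv P P' → WittEquiv Q Q' → WittEquiv (comp P Q) (comp P' Q') := by
  rintro ⟨M, N, hM, hN, h⟩ ⟨M', N', hM', hN', h'⟩
  have key1 : ∀ (P : QuadSpace k A B) (Q : QuadSpace k B C) {M : QuadSpace k A B},
      M.IsMetabolic → WittEquiv (comp (P.sum M) Q) (comp P Q) := fun P Q M hM =>
    (comp_sum_left P M Q).wittEquiv.trans (sum_metabolic_wittEquiv _ (hM.comp_left Q))
  have key2 : ∀ (P : QuadSpace k A B) (Q : QuadSpace k B C) {M : QuadSpace k B C},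
      M.IsMetabolic → WittEquiv (comp P (Q.sum M)) (comp P Q) := fun P Q M hM =>
    (comp_sum_right P Q M).wittEquiv.trans (sum_metabolic_wittEquiv _ (hM.comp_right P))
  exact (key1 P Q hM).symm.trans (((comp_isometric h (.refl Q)).wittEquiv.trans
    (key1 P' Q hN)).trans ((key2 P' Q hM').symm.trans
      ((comp_isometric (.refl P') h').wittEquiv.trans (key2 P' Q' hN'))))

end Comp

end QuadSpace

/-- The group `WCor (X, Y)`, the Witt group of the exact category with duality `Proj (X, Y)`: classes
of quadratic spaces up to isometry modulo metabolic spaces, with addition given by orthogonal sum. -/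
def WittGroup (k A B : Type u) [CommRing k] [CommRing A] [CommRing B] [Algebra k A]
    [Algebra k B] : Type (u + 1) := Quotient (QuadSpace.wittSetoid k A B)

namespace WittGroup

open QuadSpace

variable {k A B C D : Type u} [CommRing k] [CommRing A] [CommRing B] [CommRing C] [CommRing D]
  [Algebra k A] [Algebra k B] [Algebra k C] [Algebra k D]

/-- The class of a quadratic space. -/
def mk (P : QuadSpace k A B) : WittGroup k A B := Quotient.mk _ P

theorem mk_eq {P Q : QuadSpace k A B} (h : Isometric P Q) : mk P = mk Q :=
  Quotient.sound h.wittEquiv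

theorem ind {motive : WittGroup k A B → Prop} (h : ∀ P, motive (mk P)) (x : WittGroup k A B) :
    motive x := Quotient.ind h x

instance : Zero (WittGroup k A B) := ⟨mk QuadSpace.zero⟩

instance : Add (WittGroup k A B) :=
  ⟨Quotient.map₂ QuadSpace.sum fun _ _ h _ _ h' => WittEquiv.sum h h'⟩

instance : Neg (WittGroup k A B) := ⟨Quotient.map QuadSpace.neg fun _ _ h => WittEquiv.neg h⟩

theorem mk_add (P Q : QuadSpace k A B) : mk P + mk Q = mk (P.sum Q) := rfl

instance : AddCommGroup (WittGroup k A B) where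
  add_assoc := ind fun P => ind fun Q => ind fun R => mk_eq (isometric_sum_assoc P Q R)
  zero_add := ind fun P => mk_eq ((isometric_sum_comm _ _).trans (isometric_sum_zero P))
  add_zero := ind fun P => mk_eq (isometric_sum_zero P)
  add_comm := ind fun P => ind fun Q => mk_eq (isometric_sum_comm P Q)
  neg_add_cancel := ind fun P => Quotient.sound
    ((isometric_sum_comm _ _).wittEquiv.trans (isMetabolic_sum_neg P).wittEquiv)
  nsmul := nsmulRec
  zsmul := zsmulRec

/-- Composition of Witt correspondences, induced by the tensor product of quadratic spaces. -/
def comp : WittGroup k A B → WittGroup k B C → WittGroup k A C :=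
  Quotient.map₂ QuadSpace.comp fun _ _ h _ _ h' => comp_wittEquiv h h'

end WittGroup

/-- The objects of the category `WCor k` are the smooth affine schemes `X` of finite type over `k`,
given by their coordinate algebras `k[X]`. -/
structure WCor (k : Type u) [Field k] : Type (u + 1) where
  /-- The smooth affine scheme `Spec A`. -/
  of ::
  ring : Type u
  [commRing : CommRing ring]
  [algebra : Algebra k ring]
  [smooth : Algebra.Smooth k ring]

attribute [instance] WCor.commRing WCor.algebra WCor.smooth

namespace WCor

open QuadSpace

variable {k : Type u} [Field k]

instance : Category (WCor k) where
  Hom X Y := WittGroup k X.ring Y.ring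
  id X := WittGroup.mk (graph (AlgHom.id k X.ring))
  comp Φ Ψ := WittGroup.comp Φ Ψ
  id_comp := WittGroup.ind fun P => WittGroup.mk_eq (graph_comp P)
  comp_id := WittGroup.ind fun P => WittGroup.mk_eq (comp_graph P)
  assoc := WittGroup.ind fun P => WittGroup.ind fun Q => WittGroup.ind fun R =>
    WittGroup.mk_eq (comp_assoc P Q R)

instance : Preadditive (WCor k) where
  homGroup X Y := inferInstanceAs (AddCommGroup (WittGroup k X.ring Y.ring))
  add_comp _ _ _ := WittGroup.ind fun P => WittGroup.ind fun P' => WittGroup.ind fun Q =>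
    WittGroup.mk_eq (comp_sum_left P P' Q)
  comp_add _ _ _ := WittGroup.ind fun P => WittGroup.ind fun Q => WittGroup.ind fun Q' =>
    WittGroup.mk_eq (comp_sum_right P Q Q')

/-- The functor `Sm_k → WCor k` on morphisms: the Witt correspondence given by a morphism
`Spec A → Spec B` of smooth affine schemes. -/
def ofAlgHom {A B : Type u} [CommRing A] [CommRing B] [Algebra k A] [Algebra k B]
    [Algebra.Smooth k A] [Algebra.Smooth k B] (φ : B →ₐ[k] A) : of (k := k) A ⟶ of B :=
  WittGroup.mk (graph φ)

end WCor

instance smooth_polynomial (k A : Type u) [Field k] [CommRing A] [Algebra k A]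
    [Algebra.Smooth k A] : Algebra.Smooth k A[X] where
  formallySmooth := Algebra.FormallySmooth.comp k A A[X]
  finitePresentation := Algebra.FinitePresentation.trans k A A[X]

instance smooth_away (k A : Type u) [Field k] [CommRing A] [Algebra k A]
    [Algebra.Smooth k A] (f : A) : Algebra.Smooth k (Localization.Away f) :=
  have : Algebra.Smooth A (Localization.Away f) := Algebra.Smooth.of_isLocalization_Away f
  Algebra.Smooth.comp k A (Localization.Away f)

section Presheaf

variable {k : Type u} [Field k]

/- A presheaf with Witt transfers is an additive functor from the opposite of `WCor k` to abelian
groups. Additivity means that it takes disjoint unions, which are the biproducts of the additive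
category `WCor k`, to direct sums. -/
variable (F : (WCor k)ᵒᵖ ⥤ AddCommGrpCat.{w})

/-- The group `F (Spec A)` for a smooth `k`-algebra `A`. -/
abbrev Sec (A : Type u) [CommRing A] [Algebra k A] [Algebra.Smooth k A] : Type w :=
  F.obj (Opposite.op (WCor.of A))

/-- The inverse image homomorphism `F (Spec A) → F (Spec B)` along a morphism `Spec B → Spec A`. -/
def Sec.map {A B : Type u} [CommRing A] [Algebra k A] [Algebra.Smooth k A] [CommRing B]
    [Algebra k B] [Algebra.Smooth k B] (φ : A →ₐ[k] B) : Sec F A →+ Sec F B :=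
  (F.map (WCor.ofAlgHom φ).op).hom

/-- `F` is homotopy invariant: the projection `X × 𝔸¹ → X` induces an isomorphism
`F (X) → F (X × 𝔸¹)` for every smooth affine `X`. -/
def IsHomotopyInvariant : Prop :=
  ∀ (A : Type u) [CommRing A] [Algebra k A] [Algebra.Smooth k A],
    Function.Bijective (Sec.map F (Polynomial.CAlgHom : A →ₐ[k] A[X]))

/-- `F` is a sheaf on `Sm_k` in the Zariski topology: for every covering of `X = Spec A` by principal
open subschemes `D (f) = Spec A_f`, `f ∈ s`, every family of sections on the `D (f)` that agree on
intersections (on every principal open `D (h)` contained in `D (f) ∩ D (g)`) glues to a unique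
section on `X`. Here `D (h) ⊆ D (f)` if and only if there is a homomorphism of `A`-algebras
`A_f → A_h`, which is then unique. -/
def IsZariskiSheaf : Prop :=
  ∀ (A : Type u) [CommRing A] [Algebra k A] [Algebra.Smooth k A] (s : Set A), Ideal.span s = ⊤ →
    ∀ x : (∀ f : s, Sec F (Localization.Away f.1)),
      (∀ (f g : s) (h : A) (φ : Localization.Away f.1 →ₐ[A] Localization.Away h)
        (ψ : Localization.Away g.1 →ₐ[A] Localization.Away h),
        Sec.map F (φ.restrictScalars k) (x f) = Sec.map F (ψ.restrictScalars k) (x g)) →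
      ∃! y : Sec F A, ∀ f : s, Sec.map F (IsScalarTower.toAlgHom k A (Localization.Away f.1)) y = x f

section OpenSec

variable (R : Type u) [CommRing R] [Algebra k R] [Algebra.Smooth k R]

/-- The group `F (W)` for an open subscheme `W` (not necessarily affine) of a smooth affine scheme
`Spec R`: compatible families of sections on the principal open subschemes `D (f) ⊆ W`. -/
def openSec (W : Opens (PrimeSpectrum R)) :
    AddSubgroup (∀ f : {f : R // PrimeSpectrum.basicOpen f ≤ W}, Sec F (Localization.Away f.1)) where
  carrier := {x | ∀ (f g : {f : R // PrimeSpectrum.basicOpen f ≤ W})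
    (φ : Localization.Away f.1 →ₐ[R] Localization.Away g.1),
    Sec.map F (φ.restrictScalars k) (x f) = x g}
  add_mem' {x y} hx hy f g φ := by
    rw [Pi.add_apply, Pi.add_apply, map_add, hx f g φ, hy f g φ]
  zero_mem' f g φ := map_zero _
  neg_mem' {x} hx f g φ := by rw [Pi.neg_apply, Pi.neg_apply, map_neg, hx f g φ]

/-- Restriction `F (W) → F (W')` for `W' ⊆ W`. -/
def openSec.res {W W' : Opens (PrimeSpectrum R)} (h : W' ≤ W) :
    openSec F R W →+ openSec F R W' where
  toFun x := ⟨fun f => x.1 ⟨f.1, f.2.trans h⟩, fun f g φ =>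
    x.2 ⟨f.1, f.2.trans h⟩ ⟨g.1, g.2.trans h⟩ φ⟩
  map_zero' := rfl
  map_add' _ _ := rfl

variable {R} {S : Type u} [CommRing S] (j : R →+* S)

/-- The open neighbourhoods in `Spec R` of the image of an open `V ⊆ Spec S`, ordered by reverse
inclusion. -/
abbrev OpenNhd (V : Opens (PrimeSpectrum S)) : Type u :=
  {W : Opens (PrimeSpectrum R) // ∀ x ∈ V, PrimeSpectrum.comap j x ∈ W}ᵒᵈ

open Classical in
/-- The germ of `F` on an open subscheme `V` of `Spec S`, where `Spec S` is an inverse limit of open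
subschemes of the smooth affine scheme `Spec R`: the direct limit of the groups `F (W)` over the open
neighbourhoods `W` of `V` in `Spec R`. -/
def Germ (V : Opens (PrimeSpectrum S)) : Type (max u w) :=
  AddCommGroup.DirectLimit (ι := OpenNhd j V) (fun W => openSec F R (OrderDual.ofDual W).1)
    fun _ _ h => openSec.res F R h

open Classical in
noncomputable instance (V : Opens (PrimeSpectrum S)) : AddCommGroup (Germ F j V) :=
  inferInstanceAs (AddCommGroup (AddCommGroup.DirectLimit _ _))

open Classical in
/-- The germ on `V` of a section on an open neighbourhood `W` of `V`. -/
noncomputable def Germ.of {V : Opens (PrimeSpectrum S)} (W : Opens (PrimeSpectrum R))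
    (hW : ∀ x ∈ V, PrimeSpectrum.comap j x ∈ W) : openSec F R W →+ Germ F j V :=
  AddMonoidHom.mk' (AddCommGroup.DirectLimit.of
    (fun W : OpenNhd j V => openSec F R (OrderDual.ofDual W).1) (fun _ _ h => openSec.res F R h)
    (OrderDual.toDual ⟨W, hW⟩)) fun x y => map_add (AddCommGroup.DirectLimit.of
    (fun W : OpenNhd j V => openSec F R (OrderDual.ofDual W).1) (fun _ _ h => openSec.res F R h)
    (OrderDual.toDual ⟨W, hW⟩)) x y

theorem Germ.of_res {V : Opens (PrimeSpectrum S)} {W W' : Opens (PrimeSpectrum R)}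
    (hW : ∀ x ∈ V, PrimeSpectrum.comap j x ∈ W) (hW' : ∀ x ∈ V, PrimeSpectrum.comap j x ∈ W')
    (h : W' ≤ W) (x : openSec F R W) :
    Germ.of F j W' hW' (openSec.res F R h x) = Germ.of F j W hW x := by
  classical
  exact AddCommGroup.DirectLimit.of_f
    (G := fun W : OpenNhd j V => openSec F R (OrderDual.ofDual W).1)
    (f := fun _ _ h => openSec.res F R h) (i := OrderDual.toDual ⟨W, hW⟩)
    (j := OrderDual.toDual ⟨W', hW'⟩) h x

instance (V : Opens (PrimeSpectrum S)) : Nonempty (OpenNhd j V) :=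
  ⟨OrderDual.toDual ⟨⊤, fun _ _ => trivial⟩⟩

instance (V : Opens (PrimeSpectrum S)) : IsDirectedOrder (OpenNhd j V) where
  directed W W' := ⟨OrderDual.toDual ⟨(OrderDual.ofDual W).1 ⊓ (OrderDual.ofDual W').1,
    fun x hx => ⟨(OrderDual.ofDual W).2 x hx, (OrderDual.ofDual W').2 x hx⟩⟩,
    show _ ≤ (OrderDual.ofDual W).1 from inf_le_left,
    show _ ≤ (OrderDual.ofDual W').1 from inf_le_right⟩

theorem Germ.exists_of {V : Opens (PrimeSpectrum S)} (z : Germ F j V) :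
    ∃ (W : Opens (PrimeSpectrum R)) (hW : ∀ x ∈ V, PrimeSpectrum.comap j x ∈ W)
      (x : openSec F R W), Germ.of F j W hW x = z := by
  classical
  exact AddCommGroup.DirectLimit.induction_on (C := fun z => ∃ (W : Opens (PrimeSpectrum R))
    (hW : ∀ x ∈ V, PrimeSpectrum.comap j x ∈ W) (x : openSec F R W), Germ.of F j W hW x = z) z
    fun W x => ⟨(OrderDual.ofDual W).1, (OrderDual.ofDual W).2, x, rfl⟩

open Classical in
/-- Restriction of germs `F (V) → F (V')` for `V' ⊆ V`. -/
noncomputable def Germ.res {V V' : Opens (PrimeSpectrum S)} (h : V' ≤ V) :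
    Germ F j V →+ Germ F j V' :=
  let g := AddCommGroup.DirectLimit.lift
    (fun W : OpenNhd j V => openSec F R (OrderDual.ofDual W).1) (fun _ _ h => openSec.res F R h)
    (Germ F j V')
    (fun W => Germ.of F j (OrderDual.ofDual W).1 fun x hx => (OrderDual.ofDual W).2 x (h hx))
    fun _ _ hW x => Germ.of_res F j _ _ hW x
  AddMonoidHom.mk' g fun x y => map_add g x y

theorem Germ.res_of {V V' : Opens (PrimeSpectrum S)} (h : V' ≤ V) (W : Opens (PrimeSpectrum R))
    (hW : ∀ x ∈ V, PrimeSpectrum.comap j x ∈ W) (x : openSec F R W) :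
    Germ.res F j h (Germ.of F j W hW x) = Germ.of F j W (fun x hx => hW x (h hx)) x := by
  classical
  exact AddCommGroup.DirectLimit.lift_of (P := Germ F j V') (i := OrderDual.toDual ⟨W, hW⟩)
    (fun W : OpenNhd j V =>
      Germ.of F j (OrderDual.ofDual W).1 fun x hx => (OrderDual.ofDual W).2 x (h hx))
    (fun _ _ hW x => Germ.of_res F j _ _ hW x) x

theorem Germ.res_res {V V' V'' : Opens (PrimeSpectrum S)} (h : V' ≤ V) (h' : V'' ≤ V')
    (x : Germ F j V) : Germ.res F j h' (Germ.res F j h x) = Germ.res F j (h'.trans h) x := by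
  obtain ⟨W, hW, x, rfl⟩ := Germ.exists_of F j x
  rw [Germ.res_of, Germ.res_of, Germ.res_of]

end OpenSec

section Excision

variable (A : Type u) [CommRing A] [Algebra k A] [Algebra.Smooth k A] (p : Ideal A) [p.IsPrime]

/-- The coordinate ring `𝒪_{X,x}[T]` of the affine line `𝔸¹_U` over `U = Spec 𝒪_{X,x}`, where
`X = Spec A` and the point `x` is the prime ideal `p`. -/
abbrev LineRing : Type u := (Localization.AtPrime p)[X]

/-- The homomorphism `A[T] → A_p[T]` that gives `𝔸¹_U → 𝔸¹_X`. -/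
noncomputable abbrev lineMap : A[X] →+* LineRing A p :=
  Polynomial.mapRingHom (algebraMap A (Localization.AtPrime p))

/-- The zero section `0_U` of `𝔸¹_U`, the closed subset `T = 0`. -/
def zeroSection : Set (PrimeSpectrum (LineRing A p)) :=
  PrimeSpectrum.zeroLocus {(Polynomial.X : LineRing A p)}

variable {A p} in
/-- The open subset `V - 0_U` of `V ⊆ 𝔸¹_U`. -/
def puncture (V : Opens (PrimeSpectrum (LineRing A p))) : Opens (PrimeSpectrum (LineRing A p)) :=
  ⟨V \ zeroSection A p, V.isOpen.sdiff (PrimeSpectrum.isClosed_zeroLocus _)⟩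

variable {A p} in
theorem puncture_le (V : Opens (PrimeSpectrum (LineRing A p))) : puncture V ≤ V :=
  fun _ hx => hx.1

variable {A p} in
theorem puncture_mono {V V' : Opens (PrimeSpectrum (LineRing A p))} (h : V' ≤ V) :
    puncture V' ≤ puncture V := fun _ hx => ⟨h hx.1, hx.2⟩

/-- The group `F (V - 0_U) / F (V)`, the cokernel of the restriction `F (V) → F (V - 0_U)`. -/
abbrev PairSec (V : Opens (PrimeSpectrum (LineRing A p))) : Type (max u w) :=
  Germ F (lineMap A p) (puncture V) ⧸ (Germ.res F (lineMap A p) (puncture_le V)).range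

/-- The restriction homomorphism `F (V - 0_U) / F (V) → F (V' - 0_U) / F (V')` for `V' ⊆ V`. -/
noncomputable def PairSec.res {V V' : Opens (PrimeSpectrum (LineRing A p))} (h : V' ≤ V) :
    PairSec F A p V →+ PairSec F A p V' :=
  QuotientAddGroup.map _ _ (Germ.res F (lineMap A p) (puncture_mono h)) <| by
    rintro _ ⟨x, rfl⟩
    exact ⟨Germ.res F (lineMap A p) h x, by rw [Germ.res_res, Germ.res_res]⟩

end Excision

end Presheaf

end WittTransfers

/-! Injectivity is gluing. If a section on V - 0 agrees on V' - 0 with a section on a smaller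
neighbourhood V' of the zero section, the two glue to a section on V, because V is the union of V -
0 and V'.

Surjectivity needs a decomposition. It suffices to write a section a on V - 0, restricted to V' - 0
for some smaller V', as b - c with b defined on 𝔸¹ - 0 and c on V'. Then b - a on V - 0 and c on V'
agree on the overlap and glue to a section on V, so b and a have the same class. After spreading out
from U to Spec A one may take V' = D(g) with g(0) = s not in p, and a defined on D(sTg). This
decomposition is `exists_map_eq_add_map`, the heart of the proof.

It comes from transfers along zero loci of monic polynomials in a second coordinate Y. Put G = g/s,
so that G(0) = 1. Over D(sT) the polynomial Y^(N+2) - T G(Y) is coprime to s Y g(Y). Hence its zero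
locus is a finite correspondence to D(sTg), and transferring a along it gives b. Over D(sTg) it is
deformed through Y^(N+2) + G(Y) (-T + t c Y + t d Y (Y - T)). The constants c, d are chosen so that
at t = 1 this equals (Y - T) f with f(T) = f(0) = 1, and c, d, f are already defined over D(sg),
where T need not be invertible (`exists_splitting`). Since f(T) = 1, the zero locus at t = 1 is the
disjoint union of the diagonal Y = T and the zero locus of f. The diagonal returns a, and the zero
locus of f gives the section c on D(sg).

To carry Witt transfers, these finite schemes need symmetric forms that vary well in families. The
form is (x, y) ↦ residue of xy/f, expressed by `topCoeff`. It is perfect for every monic f and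
commutes with base change. On the diagonal it restricts to the unit form, so the diagonal
contributes exactly the identity correspondence (`rootSpace_isometric_graph_sum`). Homotopy
invariance identifies t = 0 with t = 1 (`Sec.map_aeval_eq`). -/

namespace WittTransfers

namespace QuadSpace

/-! ### Quadratic spaces given by finite algebras with a functional -/

section AlgSpace

variable {k B B' D : Type u} [CommRing k] [CommRing B] [CommRing B'] [CommRing D] [Algebra k B]
  [Algebra k B'] [Algebra k D]

/-- The quadratic space `(x, y) ↦ l (x y)` on a finite projective `B`-algebra `E`, for a `B`-linear
functional `l` that makes this form perfect. -/
def algSpace (E : Type u) [CommRing E] [Algebra B E] [Algebra k E] [IsScalarTower k B E]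
    [Module.Finite B E] [Module.Projective B E] (l : E →ₗ[B] B)
    (hl : Function.Bijective ((LinearMap.mul B E).compr₂ l)) (act : D →ₐ[k] E) :
    QuadSpace k B D where
  carrier := E
  act := (Algebra.lmul B E : E →+* Module.End B E).comp (act : D →+* E)
  act_algebraMap c x := by simp [Algebra.smul_def, ← IsScalarTower.algebraMap_apply]
  form := (LinearMap.mul B E).compr₂ l
  form_symm x y := by simp [mul_comm]
  form_act b x y := by simp [mul_left_comm, mul_assoc]
  form_bijective := hl

section

variable {E E' : Type u} [CommRing E] [Algebra B E] [Algebra k E] [IsScalarTower k B E]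
  [Module.Finite B E] [Module.Projective B E] (l : E →ₗ[B] B)
  (hl : Function.Bijective ((LinearMap.mul B E).compr₂ l)) (act : D →ₐ[k] E)
  [CommRing E'] [Algebra B' E'] [Algebra k E'] [IsScalarTower k B' E']
  [Module.Finite B' E'] [Module.Projective B' E'] (l' : E' →ₗ[B'] B')
  (hl' : Function.Bijective ((LinearMap.mul B' E').compr₂ l')) (act' : D →ₐ[k] E')

/-- The inverse image of `algSpace E` along `φ : B → B'`. -/
theorem graph_comp_algSpace (φ : B →ₐ[k] B') (ψ : E →+* E') (hψ : ∀ b x, ψ (b • x) = φ b • ψ x)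
    (hψl : ∀ x, l' (ψ x) = φ (l x)) (hact : ∀ d, ψ (act d) = act' d)
    (hspan : ∀ y, y ∈ Submodule.span B' (Set.range ψ)) :
    Isometric (comp (graph φ) (algSpace E l hl act)) (algSpace E' l' hl' act') := by
  let Q := algSpace E l hl act
  let R := algSpace E' l' hl' act'
  let g : Tensor (graph φ) Q →ₗ[B'] R.carrier :=
    tensorLift (graph φ) Q (fun (b : B') (x : E) => (b • ψ x : E'))
      (fun p p' x => add_smul (R := B') (M := E') p p' (ψ x))
      (fun (p : B') (x x' : E) => show (p • ψ (x + x') : E') = p • ψ x + p • ψ x' by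
        rw [map_add, smul_add])
      (fun a p x => mul_smul (α := B') (β := E') a p (ψ x))
      (fun (b : B) (p : B') (x : E) => show ((φ b * p) • ψ x : E') = p • ψ (b • x) by
        rw [hψ, mul_comm, mul_smul])
  have hg : ∀ (b : B') (x : E), g (tmk (graph φ) Q b x) = (b • ψ x : E') := fun _ _ => rfl
  refine Isometric.of_tensor (R := R) g ?_ ?_ ?_
  · intro d (b : B') (x : E)
    change (b • ψ (act d * x) : E') = act' d * b • ψ x
    rw [map_mul, hact, mul_smul_comm]
  · intro (b : B') (x : E) (b' : B') (x' : E)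
    change l' (b • ψ x * b' • ψ x') = b * (φ (l (x * x')) * b')
    rw [smul_mul_smul_comm, map_smul, ← map_mul, hψl, smul_eq_mul]
    ring
  · intro y
    have hy : (y : E') ∈ Submodule.span B' (Set.range ψ) := hspan y
    induction hy using Submodule.span_induction with
    | mem y h =>
      obtain ⟨x, rfl⟩ := h
      exact ⟨tmk (graph φ) Q (1 : B') x, (hg 1 x).trans (one_smul B' (ψ x))⟩
    | zero => exact ⟨0, map_zero g⟩
    | add y z _ _ hy hz =>
      obtain ⟨v, rfl⟩ := hy
      obtain ⟨w, rfl⟩ := hz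
      exact ⟨v + w, map_add g v w⟩
    | smul b y _ hy =>
      obtain ⟨v, rfl⟩ := hy
      exact ⟨b • v, map_smul g b v⟩

end

/-- The orthogonal decomposition of `algSpace E` given by a decomposition of the algebra `E` in which
one factor is the base `B`. -/
theorem algSpace_isometric_graph_sum {E E' : Type u} [CommRing E] [Algebra B E] [Algebra k E]
    [IsScalarTower k B E] [Module.Finite B E] [Module.Projective B E] (l : E →ₗ[B] B)
    (hl : Function.Bijective ((LinearMap.mul B E).compr₂ l)) (act : D →ₐ[k] E)
    [CommRing E'] [Algebra B E'] [Algebra k E'] [IsScalarTower k B E']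
    [Module.Finite B E'] [Module.Projective B E'] (l' : E' →ₗ[B] B)
    (hl' : Function.Bijective ((LinearMap.mul B E').compr₂ l')) (act' : D →ₐ[k] E')
    (φ : D →ₐ[k] B) (π : E →ₐ[B] B) (π' : E →ₐ[B] E') (hπ : ∀ d, π (act d) = φ d)
    (hπ' : ∀ d, π' (act d) = act' d) (hform : ∀ z, l z = π z + l' (π' z))
    (hsurj : ∀ y y', ∃ x, π x = y ∧ π' x = y') :
    Isometric (algSpace E l hl act) ((graph φ).sum (algSpace E' l' hl' act')) := by
  let f : (algSpace E l hl act).carrier →ₗ[B] ((graph φ).sum (algSpace E' l' hl' act')).carrier :=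
    (π.toLinearMap.prod π'.toLinearMap : E →ₗ[B] (B × E'))
  refine Isometric.of_surjective f ?_ ?_ ?_
  · intro d (x : E)
    change (π (act d * x), π' (act d * x)) = (φ d * π x, act' d * π' x)
    rw [map_mul, map_mul, hπ, hπ']
  · intro (x : E) (y : E)
    change π x * π y + l' (π' x * π' y) = l (x * y)
    rw [hform, map_mul π, map_mul π']
  · intro (y : B × E')
    obtain ⟨x, h, h'⟩ := hsurj y.1 y.2
    exact ⟨x, Prod.ext h h'⟩

/-- The graph of a composition. -/
theorem graph_comp_graph {A : Type u} [CommRing A] [Algebra k A] (φ : A →ₐ[k] B)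
    (ψ : B →ₐ[k] D) : Isometric (comp (graph ψ) (graph φ)) (graph (ψ.comp φ)) := by
  let g : Tensor (graph ψ) (graph φ) →ₗ[D] (graph (ψ.comp φ)).carrier :=
    tensorLift (graph ψ) (graph φ) (fun (d : D) (b : B) => (d * ψ b : D))
      (fun (p p' : D) (x : B) => add_mul p p' (ψ x))
      (fun (p : D) (x x' : B) => show p * ψ (x + x') = p * ψ x + p * ψ x' by rw [map_add, mul_add])
      (fun (a p : D) (x : B) => mul_assoc a p (ψ x))
      (fun (b : B) (p : D) (x : B) => show ψ b * p * ψ x = p * ψ (b * x) by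
        rw [map_mul]; ring)
  have hg : ∀ (d : D) (b : B), g (tmk (graph ψ) (graph φ) d b) = (d * ψ b : D) := fun _ _ => rfl
  refine Isometric.of_tensor (R := graph (ψ.comp φ)) g ?_ ?_ ?_
  · intro a (d : D) (b : B)
    change d * ψ (φ a * b) = ψ (φ a) * (d * ψ b)
    rw [map_mul]; ring
  · intro (d : D) (b : B) (d' : D) (b' : B)
    change d * ψ b * (d' * ψ b') = d * (ψ (b * b') * d')
    rw [map_mul]; ring
  · intro (d : D)
    exact ⟨tmk (graph ψ) (graph φ) d (1 : B), (hg d 1).trans (by rw [map_one, mul_one])⟩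

end AlgSpace

end QuadSpace

/-! ### The residue form on B[Y]/f -/

section ResidueForm

open Polynomial

variable {B : Type u} [CommRing B] {f : B[X]} (hf : f.Monic)

/-- The functional on `B[Y] / f` that takes the coefficient of `Y ^ (n - 1)`, where `n = deg f`. -/
noncomputable def topCoeff : AdjoinRoot f →ₗ[B] B :=
  lcoeff B (f.natDegree - 1) ∘ₗ AdjoinRoot.modByMonicHom hf

theorem topCoeff_mk (p : B[X]) :
    topCoeff hf (AdjoinRoot.mk f p) = (p %ₘ f).coeff (f.natDegree - 1) := rfl

theorem topCoeff_mk_of_degree_lt {p : B[X]} (hp : p.degree < f.degree) :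
    topCoeff hf (AdjoinRoot.mk f p) = p.coeff (f.natDegree - 1) := by
  nontriviality B
  rw [topCoeff_mk, (modByMonic_eq_self_iff hf).2 hp]

/-- A nonzero class has a representative r of degree less than n = deg f. Multiplying r by Y^(n - 1
- deg r) moves its leading coefficient to degree n - 1 without reaching degree n, so no reduction
modulo f interferes and the functional returns that coefficient. -/
theorem topCoeff_mul_injective : Function.Injective
    ((LinearMap.mul B (AdjoinRoot f)).compr₂ (topCoeff hf)) := by
  rcases subsingleton_or_nontrivial B with _ | _
  · have := Module.subsingleton B (AdjoinRoot f)
    exact Function.injective_of_subsingleton _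
  rw [injective_iff_map_eq_zero]
  intro x hx
  obtain ⟨p, rfl⟩ := AdjoinRoot.mk_surjective x
  set r := p %ₘ f with hr
  have hpr : AdjoinRoot.mk f p = AdjoinRoot.mk f r := (AdjoinRoot.mk_leftInverse hf _).symm
  rw [hpr] at hx ⊢
  by_contra h0
  have hr0 : r ≠ 0 := fun h => h0 (by rw [h, map_zero])
  have hdeg : r.degree < f.degree := degree_modByMonic_lt p hf
  have hlt : r.natDegree < f.natDegree := natDegree_lt_natDegree hr0 hdeg
  have h := LinearMap.congr_fun hx (AdjoinRoot.mk f (X ^ (f.natDegree - 1 - r.natDegree)))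
  rw [LinearMap.compr₂_apply, LinearMap.mul_apply', ← map_mul, LinearMap.zero_apply,
    topCoeff_mk_of_degree_lt hf, coeff_mul_X_pow', if_pos (by omega)] at h
  · rw [show f.natDegree - 1 - (f.natDegree - 1 - r.natDegree) = r.natDegree by omega] at h
    exact hr0 (leadingCoeff_eq_zero.1 h)
  · rw [degree_eq_natDegree hf.ne_zero]
    refine degree_lt_iff_coeff_zero _ _ |>.2 fun m hm => ?_
    rw [coeff_mul_X_pow']
    split_ifs with h'
    · exact coeff_eq_zero_of_natDegree_lt (by omega)
    · rfl

/-- In the basis 1, Y, ..., Y^(n-1) the Gram matrix is zero above the antidiagonal and 1 on it, so a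
prescribed functional is matched one basis vector at a time. -/
theorem topCoeff_mul_surjective : Function.Surjective
    ((LinearMap.mul B (AdjoinRoot f)).compr₂ (topCoeff hf)) := by
  rcases subsingleton_or_nontrivial B with _ | _
  · exact fun φ => ⟨0, LinearMap.ext fun x => Subsingleton.elim _ _⟩
  intro φ
  have hX : ∀ i, i < f.natDegree → topCoeff hf (AdjoinRoot.mk f (X ^ i)) =
      if i = f.natDegree - 1 then 1 else 0 := fun i hi => by
    rw [topCoeff_mk_of_degree_lt hf, coeff_X_pow]
    · simp only [eq_comm]
    · rw [degree_X_pow, degree_eq_natDegree hf.ne_zero]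
      exact_mod_cast hi
  have key : ∀ m, m ≤ f.natDegree → ∃ x, ∀ i < m,
      topCoeff hf (x * AdjoinRoot.mk f (X ^ i)) = φ (AdjoinRoot.mk f (X ^ i)) := by
    intro m
    induction m with
    | zero => exact fun _ => ⟨0, fun i hi => absurd hi (Nat.not_lt_zero i)⟩
    | succ m ih =>
      intro hm
      obtain ⟨x, hx⟩ := ih (by omega)
      -- The vector Y^(n-1-m) pairs to 0 with Y^i for i < m and to 1 with Y^m, so adding a multiple
      -- of it corrects the value at Y^m and keeps the earlier ones.
      refine ⟨x + (φ (AdjoinRoot.mk f (X ^ m)) - topCoeff hf (x * AdjoinRoot.mk f (X ^ m))) •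
        AdjoinRoot.mk f (X ^ (f.natDegree - 1 - m)), fun i hi => ?_⟩
      rw [add_mul, map_add, smul_mul_assoc, map_smul, ← map_mul, ← pow_add, hX _ (by omega)]
      rcases Nat.lt_succ_iff_lt_or_eq.1 hi with h | rfl
      · rw [if_neg (by omega), smul_zero, add_zero, hx i h]
      · rw [if_pos (by omega), smul_eq_mul, mul_one, add_sub_cancel]
  obtain ⟨x, hx⟩ := key _ le_rfl
  refine ⟨x, (AdjoinRoot.powerBasis' hf).basis.ext fun i => ?_⟩
  rw [PowerBasis.coe_basis, AdjoinRoot.powerBasis'_gen, ← AdjoinRoot.mk_X]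
  have h := hx i i.2
  rw [map_pow] at h
  exact h

/-- The twist by a unit v is needed because the residue form of (Y - T) f does not restrict to the
residue form of f on the zero locus of f, but to a unit multiple of it. -/
theorem topCoeff_smul_bijective {v : AdjoinRoot f} (hv : IsUnit v) : Function.Bijective
    ((LinearMap.mul B (AdjoinRoot f)).compr₂ (topCoeff hf ∘ₗ LinearMap.mulLeft B v)) := by
  have h : ⇑((LinearMap.mul B (AdjoinRoot f)).compr₂ (topCoeff hf ∘ₗ LinearMap.mulLeft B v)) =
      ((LinearMap.mul B (AdjoinRoot f)).compr₂ (topCoeff hf)) ∘ (v * ·) := by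
    ext x y
    simp [mul_assoc]
  rw [h]
  exact Function.Bijective.comp ⟨topCoeff_mul_injective hf, topCoeff_mul_surjective hf⟩
    hv.unit.mulLeft_bijective

/-- Division with remainder by a monic polynomial commutes with base change. This lets one
polynomial over B[t] interpolate between its fibres as quadratic spaces. -/
theorem topCoeff_map {B' : Type u} [CommRing B'] (φ : B →+* B') {f' : B'[X]} (hf' : f'.Monic)
    (h : f' = f.map φ) (p : B[X]) :
    topCoeff hf' (AdjoinRoot.mk f' (p.map φ)) = φ (topCoeff hf (AdjoinRoot.mk f p)) := by
  nontriviality B'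
  subst h
  rw [topCoeff_mk, topCoeff_mk, ← map_modByMonic φ hf, coeff_map, hf.natDegree_map]

/-- The functional is the residue at infinity of p/f, the coefficient of Y^(-1), so it depends only
on the fraction: lp/(lf) = p/f. -/
theorem topCoeff_mul_left {l : B[X]} (hl : l.Monic) (hlf : (l * f).Monic) (p : B[X]) :
    topCoeff hlf (AdjoinRoot.mk _ (l * p)) = topCoeff hf (AdjoinRoot.mk f p) := by
  nontriviality B
  have h : (l * p) %ₘ (l * f) = l * (p %ₘ f) := by
    refine (div_modByMonic_unique (p /ₘ f) _ hlf ⟨?_, ?_⟩).2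
    · conv_rhs => rw [← modByMonic_add_div p f]
      ring
    · rw [hl.degree_mul_comm, hl.degree_mul_comm, hl.degree_mul, hl.degree_mul]
      have : degree (p %ₘ f) < degree f := degree_modByMonic_lt p hf
      refine WithBot.add_lt_add_right ?_ this
      exact (degree_ne_bot.2 hl.ne_zero)
  rw [topCoeff_mk, topCoeff_mk, h]
  -- If f = 1, then deg f - 1 is truncated to 0 and the index computation below fails, but the
  -- remainder modulo f vanishes and both sides are 0.
  rcases Nat.eq_zero_or_pos f.natDegree with h0 | h0
  · have : f = 1 := hf.natDegree_eq_zero.1 h0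
    subst this
    simp
  · rw [hl.natDegree_mul hf, show l.natDegree + f.natDegree - 1 = l.natDegree + (f.natDegree - 1) by
      omega, mul_comm l, add_comm l.natDegree,
      coeff_mul_add_eq_of_natDegree_le ?_ le_rfl]
    · rw [hl.coeff_natDegree, mul_one]
    · have := natDegree_modByMonic_lt p hf (by rintro rfl; simp at h0)
      omega

end ResidueForm

end WittTransfers

namespace WittTransfers

open Polynomial

/-! ### Correspondences to the affine line given by monic polynomials -/

section RootSpace

variable {k A B : Type u} [Field k] [CommRing A] [CommRing B] [Algebra k A] [Algebra k B]
  [Algebra A B] [IsScalarTower k A B]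

theorem isUnit_mk_of_isCoprime {f p : B[X]} (h : IsCoprime f p) : IsUnit (AdjoinRoot.mk f p) := by
  obtain ⟨a, b, h⟩ := h
  refine IsUnit.of_mul_eq_one (AdjoinRoot.mk f b) ?_
  rw [← map_mul, ← sub_eq_zero, ← map_one (AdjoinRoot.mk f), ← map_sub, AdjoinRoot.mk_eq_zero, ← h]
  exact ⟨-a, by ring⟩

theorem isCoprime_X_of_isUnit_coeff_zero {p : B[X]} (h : IsUnit (p.coeff 0)) :
    IsCoprime p X := by
  obtain ⟨c, hc⟩ := h.exists_right_inv
  refine ⟨C c, -C c * p.divX, ?_⟩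
  conv_lhs => enter [1]; rw [← p.divX_mul_X_add]
  rw [mul_add, ← C_mul, mul_comm c, hc, C_1]
  ring

/-- For an `A`-algebra `B`, the action on `B[Y] / f` of the coordinate ring `A[T]_h` of the principal
open `D (h)` of the affine line, by which `T` acts as `Y`. -/
noncomputable def rootAct (h : A[X]) (f : B[X]) (hh : IsCoprime f (h.map (algebraMap A B))) :
    Localization.Away h →ₐ[A] AdjoinRoot f :=
  IsLocalization.Away.liftAlgHom h (f := aeval (AdjoinRoot.root f)) <| by
    rw [AdjoinRoot.aeval_eq_of_algebra]
    exact isUnit_mk_of_isCoprime hh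

theorem rootAct_algebraMap (h : A[X]) (f : B[X]) (hh : IsCoprime f (h.map (algebraMap A B)))
    (p : A[X]) : rootAct h f hh (algebraMap A[X] _ p) = AdjoinRoot.mk f (p.map (algebraMap A B)) := by
  rw [rootAct, IsLocalization.Away.liftAlgHom_apply, IsLocalization.Away.lift_eq]
  exact AdjoinRoot.aeval_eq_of_algebra _ _

/-- The quadratic space `B[Y] / f` with the form `(x, y) ↦ topCoeff (v x y)`, as a correspondence from
`Spec B` to the principal open `D (h)` of the affine line over `A`. -/
noncomputable def rootSpace (h : A[X]) (f : B[X]) (hf : f.Monic)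
    (hh : IsCoprime f (h.map (algebraMap A B))) (v : B[X]) (hv : IsCoprime f v) :
    QuadSpace k B (Localization.Away h) :=
  have := hf.finite_adjoinRoot
  have := hf.free_adjoinRoot
  QuadSpace.algSpace (AdjoinRoot f) _ (topCoeff_smul_bijective hf (isUnit_mk_of_isCoprime hv))
    ((rootAct h f hh).restrictScalars k)

variable {B' : Type u} [CommRing B'] [Algebra k B'] [Algebra A B'] [IsScalarTower k A B']

theorem algHom_away_ext {h : A[X]} {E : Type*} [CommRing E] [Algebra A E]
    {σ τ : Localization.Away h →ₐ[A] E}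
    (hX : σ (algebraMap A[X] _ X) = τ (algebraMap A[X] _ X)) : σ = τ := by
  have h1 : (σ : Localization.Away h →+* E) = τ := by
    refine IsLocalization.ringHom_ext (Submonoid.powers h) (Polynomial.ringHom_ext (fun a => ?_) hX)
    exact (σ.commutes a).trans (τ.commutes a).symm
  exact AlgHom.ext fun x => RingHom.congr_fun h1 x

/-- The inverse image of `B[Y] / f` along a homomorphism `φ` of base rings. -/
theorem graph_comp_rootSpace (φ : B →ₐ[A] B') {h : A[X]} {f : B[X]} {hf : f.Monic}
    {hh : IsCoprime f (h.map (algebraMap A B))} {v : B[X]} {hv : IsCoprime f v}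
    {f' : B'[X]} {hf' : f'.Monic}
    {hh' : IsCoprime f' (h.map (algebraMap A B'))} {v' : B'[X]} {hv' : IsCoprime f' v'}
    (hff' : f' = f.map (φ : B →+* B')) (hvv' : v' = v.map (φ : B →+* B')) :
    QuadSpace.Isometric
      (QuadSpace.comp (QuadSpace.graph (φ.restrictScalars k)) (rootSpace (k := k) h f hf hh v hv))
      (rootSpace h f' hf' hh' v' hv') := by
  have := hf.finite_adjoinRoot
  have := hf.free_adjoinRoot
  have := hf'.finite_adjoinRoot
  have := hf'.free_adjoinRoot
  let ψ : AdjoinRoot f →+* AdjoinRoot f' := AdjoinRoot.map (φ : B →+* B') f f' hff'.dvd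
  have hψmk : ∀ p, ψ (AdjoinRoot.mk f p) = AdjoinRoot.mk f' (p.map (φ : B →+* B')) := fun p => by
    have : ψ.comp (AdjoinRoot.mk f) = (AdjoinRoot.mk f').comp (mapRingHom (φ : B →+* B')) :=
      Polynomial.ringHom_ext (fun a => by simp [ψ]) (by simp [ψ])
    exact RingHom.congr_fun this p
  refine QuadSpace.graph_comp_algSpace _ _ _ _ _ _ (φ.restrictScalars k) ψ ?_ ?_ ?_ ?_
  · intro b x
    simp [Algebra.smul_def, ψ]
  · intro x
    obtain ⟨p, rfl⟩ := AdjoinRoot.mk_surjective x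
    rw [hψmk]
    simp only [LinearMap.comp_apply, LinearMap.mulLeft_apply, ← map_mul, hvv', ← Polynomial.map_mul]
    exact topCoeff_map hf (φ : B →+* B') hf' hff' (v * p)
  · intro d
    change ψ (rootAct h f hh d) = rootAct h f' hh' d
    refine RingHom.congr_fun (f := ψ.comp (rootAct h f hh : _ →+* AdjoinRoot f))
      (g := (rootAct h f' hh' : _ →+* AdjoinRoot f')) ?_ d
    refine IsLocalization.ringHom_ext (Submonoid.powers h) (RingHom.ext fun p => ?_)
    change ψ (rootAct h f hh (algebraMap _ _ p)) = rootAct h f' hh' (algebraMap _ _ p)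
    rw [rootAct_algebraMap, rootAct_algebraMap, hψmk, Polynomial.map_map]
    congr 2
    exact φ.comp_algebraMap
  · intro y
    obtain ⟨p, rfl⟩ := AdjoinRoot.mk_surjective y
    -- The powers of Y already come from B[Y]/f, so the image of ψ spans over B'.
    induction p using Polynomial.induction_on' with
    | add p q hp hq => rw [map_add]; exact add_mem hp hq
    | monomial n b =>
      have : AdjoinRoot.mk f' (monomial n b) = b • ψ (AdjoinRoot.mk f (X ^ n)) := by
        rw [hψmk, Polynomial.map_pow, map_X, AdjoinRoot.smul_mk, smul_X_eq_monomial]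
      rw [this]
      exact Submodule.smul_mem _ _ (Submodule.subset_span ⟨_, rfl⟩)

/-- If `f₁ = (Y - T) f` with `f` equal to `1` at `T`, then `B[Y] / f₁` splits off the graph of the
section `Y = T`. -/
theorem rootSpace_isometric_graph_sum {h : A[X]} {f₁ f r : B[X]} {T : B} {hf₁ : f₁.Monic}
    {hh₁ : IsCoprime f₁ (h.map (algebraMap A B))} {hv₁ : IsCoprime f₁ 1} {hf : f.Monic}
    {hh : IsCoprime f (h.map (algebraMap A B))} {hr : IsCoprime f r}
    (h₁ : f₁ = (X - C T) * f) (h₂ : (X - C T) * r = 1 - f)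
    (τ : Localization.Away h →ₐ[A] B) (hτ : τ (algebraMap A[X] _ X) = T) :
    QuadSpace.Isometric (rootSpace (k := k) h f₁ hf₁ hh₁ 1 hv₁)
      ((QuadSpace.graph (τ.restrictScalars k)).sum (rootSpace h f hf hh r hr)) := by
  have := hf.finite_adjoinRoot
  have := hf.free_adjoinRoot
  have := hf₁.finite_adjoinRoot
  have := hf₁.free_adjoinRoot
  have hfT : f.eval T = 1 := by
    have := congrArg (eval T) h₂
    simp only [eval_mul, eval_sub, eval_X, eval_C, sub_self, zero_mul, eval_one] at this
    exact (sub_eq_zero.1 this.symm).symm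
  let π : AdjoinRoot f₁ →ₐ[B] B := AdjoinRoot.liftAlgHom f₁ (AlgHom.id B B) T (by simp [h₁])
  have hπmk : ∀ p, π (AdjoinRoot.mk f₁ p) = p.eval T := fun p => by
    simp only [π, AdjoinRoot.liftAlgHom_mk]
    rfl
  let π' : AdjoinRoot f₁ →ₐ[B] AdjoinRoot f :=
    AdjoinRoot.algHomOfDvd B f₁ f ⟨X - C T, by rw [h₁, mul_comm]⟩
  have hπ'mk : ∀ p, π' (AdjoinRoot.mk f₁ p) = AdjoinRoot.mk f p := fun p => by
    have : (π' : AdjoinRoot f₁ →+* AdjoinRoot f).comp (AdjoinRoot.mk f₁) = AdjoinRoot.mk f :=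
      Polynomial.ringHom_ext (fun a => π'.commutes a) (by simp [π'])
    exact RingHom.congr_fun this p
  refine QuadSpace.algSpace_isometric_graph_sum _ _ _ _ _ _ (τ.restrictScalars k) π π' ?_ ?_ ?_ ?_
  · intro d
    have : (π.restrictScalars A).comp (rootAct h f₁ hh₁) = τ := algHom_away_ext <| by
      rw [hτ, AlgHom.comp_apply, rootAct_algebraMap, map_X]
      exact (hπmk X).trans eval_X
    exact AlgHom.congr_fun this d
  · intro d
    have : (π'.restrictScalars A).comp (rootAct h f₁ hh₁) = rootAct h f hh := algHom_away_ext <| by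
      rw [AlgHom.comp_apply, rootAct_algebraMap, rootAct_algebraMap]
      exact hπ'mk _
    exact AlgHom.congr_fun this d
  · intro z
    obtain ⟨p, rfl⟩ := AdjoinRoot.mk_surjective z
    rw [hπmk, hπ'mk]
    simp only [LinearMap.comp_apply, LinearMap.mulLeft_apply, map_one, one_mul, ← map_mul]
    obtain ⟨q, hq⟩ := X_sub_C_dvd_sub_C_eval (p := p) (a := T)
    -- Modulo f₁ the elements f and (Y - T) r are complementary idempotents: their sum is 1 and
    -- their product is f₁ r. On the first summand p acts as p(T), since (Y - T) f = f₁.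
    have e : AdjoinRoot.mk f₁ p = AdjoinRoot.mk f₁ (C (p.eval T) * f) +
        AdjoinRoot.mk f₁ ((X - C T) * (r * p)) := by
      rw [← map_add, AdjoinRoot.mk_eq_mk, h₁]
      refine ⟨q, ?_⟩
      linear_combination f * hq - p * h₂
    rw [e, map_add]
    subst h₁
    rw [topCoeff_mul_left hf (monic_X_sub_C T)]
    congr 1
    nontriviality B
    -- The polynomial f is monic of degree deg f₁ - 1, exactly the degree that the functional reads,
    -- so p(T) f contributes p(T). This is why the form on the diagonal is the unit form.
    rw [topCoeff_mk_of_degree_lt, (monic_X_sub_C T).natDegree_mul hf, natDegree_X_sub_C,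
      Nat.add_sub_cancel_left, coeff_C_mul, hf.coeff_natDegree, mul_one]
    rw [← smul_eq_C_mul]
    refine lt_of_le_of_lt (degree_smul_le _ _) ?_
    rw [degree_eq_natDegree hf.ne_zero, degree_eq_natDegree hf₁.ne_zero,
      (monic_X_sub_C T).natDegree_mul hf, natDegree_X_sub_C]
    exact_mod_cast Nat.lt_add_of_pos_left Nat.one_pos
  · intro y y'
    obtain ⟨p, rfl⟩ := AdjoinRoot.mk_surjective y'
    -- The two idempotents give the preimage of (y, p), as in the Chinese remainder theorem.
    refine ⟨AdjoinRoot.mk f₁ (C y * f + (X - C T) * r * p), ?_, ?_⟩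
    · rw [hπmk]
      simp [hfT]
    · rw [hπ'mk, AdjoinRoot.mk_eq_mk, h₂]
      exact ⟨C y - p, by ring⟩

end RootSpace

/-! ### The polynomial that contains the diagonal as a simple factor -/

section Polynomials

variable {Q : Type u} [CommRing Q]

/-- The polynomials that split off the diagonal. -/
theorem exists_splitting (G : Q[X]) (hG : G.coeff 0 = 1) (T γ : Q) (hγ : G.eval T * γ = 1) (N : ℕ) :
    ∃ c d : Q, ∃ f : Q[X], (X - C T) * f =
      X ^ (N + 2) + G * (-C T + C c * X + C d * X * (X - C T)) ∧ f.eval T = 1 ∧ f.coeff 0 = 1 := by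
  obtain ⟨q, hq⟩ := X_sub_C_dvd_sub_C_eval (p := G) (a := T)
  let S : Q[X] := ∑ i ∈ Finset.range (N + 2), X ^ i * C T ^ (N + 1 - i)
  have hS : S * (X - C T) = X ^ (N + 2) - C T ^ (N + 2) := geom_sum₂_mul X (C T) (N + 2)
  have hST : S.eval T = (N + 2) * T ^ (N + 1) := by
    simp only [S, eval_finsetSum, eval_mul, eval_pow, eval_X, eval_C]
    exact_mod_cast geom_sum₂_self T (N + 2)
  have hS0 : S.eval 0 = T ^ (N + 1) := by
    simp [S, eval_finsetSum, Finset.sum_range_succ' _ (N + 1)]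
  have hγ' : C (G.eval T) * C γ = (1 : Q[X]) := by rw [← C_mul, hγ, C_1]
  have hq0 : 1 - G.eval T = -T * q.eval 0 := by
    have := congrArg (eval 0) hq
    simpa [← coeff_zero_eq_eval_zero, mul_coeff_zero, hG] using this
  -- Here γ = 1/G(T). Vanishing of the right side at T forces c up to multiples annihilated by T,
  -- and c = 1 - T^(N+1) γ works. Then f(T) is the derivative of the right side at T, and f(T) = 1
  -- becomes T G(T) d = 1 - G(T) + T^(N+1) (1 - (N+2) + T γ q(T)). Since G(0) = 1, 1 - G(T) = -T
  -- q(0), so a factor T cancels and d exists without inverting T.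
  refine ⟨1 - T ^ (N + 1) * γ,
    -γ * q.eval 0 + T ^ N * γ * (1 - (N + 2) + T * γ * q.eval T),
    S - C (T ^ (N + 2) * γ) * q + C (1 - T ^ (N + 1) * γ) * G +
      C (-γ * q.eval 0 + T ^ N * γ * (1 - (N + 2) + T * γ * q.eval T)) * X * G, ?_, ?_, ?_⟩
  · generalize -γ * q.eval 0 + T ^ N * γ * (1 - (N + 2) + T * γ * q.eval T) = d
    simp only [C_mul, C_sub, C_1, C_pow]
    linear_combination hS + C T ^ (N + 2) * C γ * hq + C T ^ (N + 2) * hγ'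
  · simp only [eval_add, eval_sub, eval_mul, eval_C, eval_X, hST]
    linear_combination -hq0 + (T ^ (N + 1) * (-1 + (1 - (N + 2) + T * γ * q.eval T)) -
      T * q.eval 0) * hγ
  · rw [coeff_zero_eq_eval_zero] at hG ⊢
    simp only [eval_add, eval_sub, eval_mul, eval_C, eval_X, hS0, hG]
    linear_combination -T ^ (N + 1) * γ * hq0 - T ^ (N + 1) * hγ

end Polynomials
end WittTransfers

namespace WittTransfers

open Polynomial

/-! ### Transfer homomorphisms and homotopy invariance -/

section Pull

variable {k : Type u} [Field k] (F : (WCor k)ᵒᵖ ⥤ AddCommGrpCat.{w})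
variable {A B D : Type u} [CommRing A] [Algebra k A] [Algebra.Smooth k A] [CommRing B]
  [Algebra k B] [Algebra.Smooth k B] [CommRing D] [Algebra k D] [Algebra.Smooth k D]

/-- The transfer homomorphism `F (Spec B) → F (Spec A)` along a quadratic space from `Spec A` to
`Spec B`. -/
def Sec.pull (P : QuadSpace k A B) : Sec F B →+ Sec F A :=
  (F.map (Quiver.Hom.op (X := WCor.of (k := k) A) (Y := WCor.of B) (WittGroup.mk P))).hom

theorem Sec.pull_isometric {P Q : QuadSpace k A B} (h : QuadSpace.Isometric P Q) :
    Sec.pull F P = Sec.pull F Q := by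
  rw [Sec.pull, WittGroup.mk_eq h, Sec.pull]

theorem Sec.pull_graph (φ : B →ₐ[k] A) : Sec.pull F (QuadSpace.graph φ) = Sec.map F φ := rfl

theorem Sec.pull_pull (P : QuadSpace k A B) (Q : QuadSpace k B D) (x : Sec F D) :
    Sec.pull F P (Sec.pull F Q x) = Sec.pull F (QuadSpace.comp P Q) x := by
  have h := F.map_comp (Quiver.Hom.op (X := WCor.of (k := k) B) (Y := WCor.of D) (WittGroup.mk Q))
    (Quiver.Hom.op (X := WCor.of (k := k) A) (Y := WCor.of B) (WittGroup.mk P))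
  exact (congrArg (fun f => f.hom x) h).symm

theorem Sec.pull_sum [F.Additive] (P Q : QuadSpace k A B) (x : Sec F B) :
    Sec.pull F (P.sum Q) x = Sec.pull F P x + Sec.pull F Q x := by
  have h := F.map_add
    (f := (Quiver.Hom.op (X := WCor.of (k := k) A) (Y := WCor.of B) (WittGroup.mk P)))
    (g := (Quiver.Hom.op (X := WCor.of (k := k) A) (Y := WCor.of B) (WittGroup.mk Q)))
  exact congrArg (fun f => f.hom x) h

theorem Sec.map_map (φ : A →ₐ[k] B) (ψ : B →ₐ[k] D) (x : Sec F A) :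
    Sec.map F ψ (Sec.map F φ x) = Sec.map F (ψ.comp φ) x := by
  rw [← Sec.pull_graph, ← Sec.pull_graph, ← Sec.pull_graph, Sec.pull_pull,
    Sec.pull_isometric F (QuadSpace.graph_comp_graph φ ψ)]

theorem Sec.map_id (x : Sec F A) : Sec.map F (AlgHom.id k A) x = x := by
  have h := F.map_id (Opposite.op (WCor.of (k := k) A))
  exact congrArg (fun f => f.hom x) h

/-- Every section over Spec A × 𝔸¹ is pulled back from Spec A, and every point a of A gives a
section of the projection. -/
theorem Sec.map_aeval_eq (hF : IsHomotopyInvariant F) (a b : A) (x : Sec F A[X]) :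
    Sec.map F ((aeval a : A[X] →ₐ[A] A).restrictScalars k) x =
      Sec.map F ((aeval b : A[X] →ₐ[A] A).restrictScalars k) x := by
  obtain ⟨y, rfl⟩ := (hF A).2 x
  have h : ∀ c : A, ((aeval c : A[X] →ₐ[A] A).restrictScalars k).comp CAlgHom = AlgHom.id k A :=
    fun c => AlgHom.ext fun x => by simp
  rw [Sec.map_map, Sec.map_map, h, h]

end Pull

/-! ### Splitting a section near the zero section -/

section Decomposition

variable {A Q : Type u} [CommRing A] [CommRing Q] [Algebra A Q]

/-- Modulo G only Y^n remains, and Y is invertible modulo G because G(0) = 1. The perturbation e is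
arbitrary, so one argument serves the whole homotopy. -/
theorem isCoprime_X_pow_add {G : Q[X]} (hG : G.coeff 0 = 1) (n : ℕ) (e : Q[X]) :
    IsCoprime (X ^ n + G * e) G := by
  have : IsCoprime G X := isCoprime_X_of_isUnit_coeff_zero (by rw [hG]; exact isUnit_one)
  exact (this.symm.pow_left (m := n)).add_mul_left_left e

/-- This is the condition for the zero locus of f to lie in D(sTg), so that it gives a
correspondence to that open subset. Where s is invertible and g = sG, only the factors Y and G
matter. -/
theorem isCoprime_map_of_isCoprime {s : A} {g : A[X]} {f G : Q[X]}
    (hs : IsUnit (algebraMap A Q s)) (hg : g.map (algebraMap A Q) = C (algebraMap A Q s) * G)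
    (hX : IsCoprime f X) (hG : IsCoprime f G) :
    IsCoprime f ((C s * X * g).map (algebraMap A Q)) := by
  have hC : IsCoprime f (C (algebraMap A Q s)) := by
    obtain ⟨c, hc⟩ := (hs.map C).exists_left_inv
    exact ⟨0, c, by rw [hc, zero_mul, zero_add]⟩
  rw [Polynomial.map_mul, Polynomial.map_mul, map_C, map_X, hg]
  exact (hC.mul_right hX).mul_right (hC.mul_right hG)

theorem natDegree_quadratic_le (a b c T : Q) :
    (C a + C b * X + C c * X * (X - C T)).natDegree ≤ 2 := by
  compute_degree

theorem monic_X_pow_add_mul {G e : Q[X]} {N : ℕ} (hG : G.natDegree + 1 ≤ N) (he : e.natDegree ≤ 2) :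
    (X ^ (N + 2) + G * e).Monic := by
  refine monic_X_pow_add ?_
  refine lt_of_le_of_lt degree_le_natDegree ?_
  have := natDegree_mul_le (p := G) (q := e)
  exact_mod_cast (by omega : (G * e).natDegree < N + 2)

variable {k : Type u} [Field k] [Algebra k A] [Algebra.Smooth k A]
  (F : (WCor k)ᵒᵖ ⥤ AddCommGrpCat.{w})

/-- Restricting a transfer to another base is the transfer along the base-changed polynomial. It is
used for both restrictions to D(h) and for the fibres of the homotopy. -/
theorem Sec.map_pull_rootSpace {B B' : Type u} [CommRing B] [CommRing B'] [Algebra k B]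
    [Algebra k B'] [Algebra.Smooth k B] [Algebra.Smooth k B'] [Algebra A B] [Algebra A B']
    [IsScalarTower k A B] [IsScalarTower k A B'] (φ : B →ₐ[A] B') {h : A[X]} {f : B[X]}
    {hf : f.Monic} {hh : IsCoprime f (h.map (algebraMap A B))} {v : B[X]} {hv : IsCoprime f v}
    {f' : B'[X]} {hf' : f'.Monic}
    {hh' : IsCoprime f' (h.map (algebraMap A B'))} {v' : B'[X]} {hv' : IsCoprime f' v'}
    (hff' : f' = f.map (φ : B →+* B')) (hvv' : v' = v.map (φ : B →+* B'))
    (x : Sec F (Localization.Away h)) :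
    Sec.map F (φ.restrictScalars k) (Sec.pull F (rootSpace h f hf hh v hv) x) =
      Sec.pull F (rootSpace h f' hf' hh' v' hv') x := by
  rw [← Sec.pull_graph, Sec.pull_pull,
    Sec.pull_isometric F (graph_comp_rootSpace φ (hf' := hf') (hv' := hv') hff' hvv')]

set_option maxHeartbeats 400000 in
/-- Every section over `D (s T g)`, where `g` has the constant coefficient `s`, is the difference of
sections over `D (s T)` and over `D (s g)`. -/
theorem exists_map_eq_add_map [F.Additive] (hF : IsHomotopyInvariant F) (s : A) (g h : A[X])
    (hs : g.coeff 0 = s) (hh : h = C s * X * g)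
    (ρ₁ : Localization.Away (C s * X : A[X]) →ₐ[A[X]] Localization.Away h)
    (ρ₀ : Localization.Away (C s * g : A[X]) →ₐ[A[X]] Localization.Away h)
    (a : Sec F (Localization.Away h)) :
    ∃ (b : Sec F (Localization.Away (C s * X : A[X])))
      (c : Sec F (Localization.Away (C s * g : A[X]))),
      Sec.map F (ρ₁.restrictScalars k) b = a + Sec.map F (ρ₀.restrictScalars k) c := by
  let B₁ := Localization.Away (C s * X : A[X])
  let B₀ := Localization.Away (C s * g : A[X])
  let B := Localization.Away h
  have aev : ∀ (p q : A[X]), algebraMap A[X] (Localization.Away q) p =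
      (p.map (algebraMap A (Localization.Away q))).eval (algebraMap A[X] _ X) := fun p q => by
    rw [eval_map_algebraMap, aeval_algebraMap_apply, aeval_X_left_apply]
  have hu₁ : IsUnit (algebraMap A[X] B₁ (C s * X)) := IsLocalization.Away.algebraMap_isUnit _
  have hu₀ : IsUnit (algebraMap A[X] B₀ (C s * g)) := IsLocalization.Away.algebraMap_isUnit _
  rw [map_mul, IsUnit.mul_iff] at hu₁ hu₀
  let T₁ : B₁ := algebraMap A[X] B₁ X
  let T₀ : B₀ := algebraMap A[X] B₀ X
  let T : B := algebraMap A[X] B X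
  have hs₁ : IsUnit (algebraMap A B₁ s) := hu₁.1
  have hs₀ : IsUnit (algebraMap A B₀ s) := hu₀.1
  obtain ⟨σ₁, hσ₁⟩ := hs₁.exists_right_inv
  obtain ⟨σ₀, hσ₀⟩ := hs₀.exists_right_inv
  -- The inverses of s chosen over D(sT) and over D(sg) have the same image over D(h), so the
  -- normalized polynomials below agree there.
  have hσ : ρ₁ σ₁ = ρ₀ σ₀ := by
    have h1 : algebraMap A B s * ρ₁ σ₁ = 1 := by
      have := congrArg ρ₁ hσ₁
      rwa [map_mul, map_one, show ρ₁ (algebraMap A B₁ s) = algebraMap A B s from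
        (ρ₁.restrictScalars A).commutes s] at this
    have h0 : algebraMap A B s * ρ₀ σ₀ = 1 := by
      have := congrArg ρ₀ hσ₀
      rwa [map_mul, map_one, show ρ₀ (algebraMap A B₀ s) = algebraMap A B s from
        (ρ₀.restrictScalars A).commutes s] at this
    linear_combination ρ₀ σ₀ * h1 - ρ₁ σ₁ * h0
  have hnd : ∀ {Q : Type u} [CommRing Q] [Algebra A Q] (σ : Q),
      (C σ * g.map (algebraMap A Q)).natDegree ≤ g.natDegree := fun σ =>
    (natDegree_C_mul_le _ _).trans (natDegree_map_le)
  have hc0 : ∀ {Q : Type u} [CommRing Q] [Algebra A Q] (σ : Q), algebraMap A Q s * σ = 1 →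
      (C σ * g.map (algebraMap A Q)).coeff 0 = 1 := fun σ hσ => by
    rw [coeff_C_mul, coeff_map, hs, mul_comm, hσ]
  have hgm : ∀ {Q : Type u} [CommRing Q] [Algebra A Q] (σ : Q), algebraMap A Q s * σ = 1 →
      g.map (algebraMap A Q) = C (algebraMap A Q s) * (C σ * g.map (algebraMap A Q)) :=
    fun σ hσ => by rw [← mul_assoc, ← C_mul, hσ, C_1, one_mul]
  let φ₁ : B₁ →ₐ[A] B := ρ₁.restrictScalars A
  let φ₀ : B₀ →ₐ[A] B := ρ₀.restrictScalars A
  have hT₁ : φ₁ T₁ = T := ρ₁.commutes X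
  have hT₀ : φ₀ T₀ = T := ρ₀.commutes X
  have hσ' : algebraMap A B s * φ₀ σ₀ = 1 := by
    rw [← φ₀.commutes, ← map_mul, hσ₀, map_one]
  -- These are g/s, with constant coefficient 1, over D(sT), over D(sg), over D(h) and over D(h) ×
  -- 𝔸¹.
  let G₁ : B₁[X] := C σ₁ * g.map (algebraMap A B₁)
  let G₀ : B₀[X] := C σ₀ * g.map (algebraMap A B₀)
  let G : B[X] := C (φ₀ σ₀) * g.map (algebraMap A B)
  let G' : B[X][X] := C (C (φ₀ σ₀)) * g.map (algebraMap A B[X])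
  have hσ'' : algebraMap A B[X] s * C (φ₀ σ₀) = 1 := by
    rw [show algebraMap A B[X] s = C (algebraMap A B s) from rfl, ← C_mul, hσ', C_1]
  have hGφ₁ : G₁.map (φ₁ : B₁ →+* B) = G := by
    simp only [G₁, G, Polynomial.map_mul, map_C, Polynomial.map_map, AlgHom.comp_algebraMap]
    rw [show (φ₁ : B₁ →+* B) σ₁ = φ₀ σ₀ from hσ]
  have hGφ₀ : G₀.map (φ₀ : B₀ →+* B) = G := by
    simp only [G₀, G, Polynomial.map_mul, map_C, Polynomial.map_map, AlgHom.comp_algebraMap]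
    rfl
  have hGev : ∀ t : B, G'.map ((aeval t : B[X] →ₐ[B] B).restrictScalars A : B[X] →+* B) = G := by
    intro t
    simp only [G', G, Polynomial.map_mul, map_C, Polynomial.map_map, AlgHom.comp_algebraMap]
    congr 2
    exact aeval_C _ _
  -- At Y = T the polynomial G takes the value g(T)/s, which is invertible on D(sg).
  obtain ⟨γ, hγ⟩ : ∃ γ, G₀.eval T₀ * γ = 1 := by
    have h1 : IsUnit (G₀.eval T₀) := by
      rw [eval_mul, eval_C, ← aev]
      exact (IsUnit.of_mul_eq_one _ ((mul_comm _ _).trans hσ₀)).mul hu₀.2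
    exact h1.exists_right_inv
  -- The product of G with a quadratic polynomial has degree at most deg g + 2 < N + 2, so Y^(N+2)
  -- stays the leading term.
  let N := g.natDegree + 1
  obtain ⟨c, d, f, hf, hfT, hf0⟩ := exists_splitting G₀ (hc0 σ₀ hσ₀) T₀ γ hγ N
  -- This is the end t = 0 of the homotopy, which involves neither c nor d and is thus defined on
  -- D(sT). The zero terms keep the common shape to which `mon` and `cop` apply.
  let e₁ : B₁[X] := C (-T₁) + C 0 * X + C 0 * X * (X - C T₁)
  let e : B → B[X] := fun t =>
    C (-T) + C (t * φ₀ c) * X + C (t * φ₀ d) * X * (X - C T)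
  -- The inner variable, which multiplies c and d, is the homotopy parameter t; the outer variable
  -- is Y.
  let e' : B[X][X] := C (-C T) + C (X * C (φ₀ c)) * X + C (X * C (φ₀ d)) * X * (X - C (C T))
  have mon : ∀ {Q : Type u} [CommRing Q] [Algebra A Q] (σ a b c' T' : Q),
      (X ^ (N + 2) + (C σ * g.map (algebraMap A Q)) *
        (C a + C b * X + C c' * X * (X - C T'))).Monic := fun σ a b c' T' =>
    monic_X_pow_add_mul (Nat.succ_le_succ (hnd σ)) (natDegree_quadratic_le _ _ _ _)
  -- The constant coefficient of the polynomial is a, which will be -T. Coprimality to Y therefore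
  -- requires T to be invertible, which holds over D(sT), D(h) and D(h) × 𝔸¹.
  have cop : ∀ {Q : Type u} [CommRing Q] [Algebra A Q] (σ a b c' T' : Q),
      algebraMap A Q s * σ = 1 → IsUnit a →
      IsCoprime (X ^ (N + 2) + (C σ * g.map (algebraMap A Q)) *
        (C a + C b * X + C c' * X * (X - C T'))) (h.map (algebraMap A Q)) := by
    intro Q _ _ σ a b c' T' hσ ha
    rw [hh]
    refine isCoprime_map_of_isCoprime (IsUnit.of_mul_eq_one _ hσ) (hgm σ hσ)
      (isCoprime_X_of_isUnit_coeff_zero ?_) (isCoprime_X_pow_add (hc0 σ hσ) _ _)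
    rw [coeff_add, mul_coeff_zero, hc0 σ hσ]
    simpa [mul_coeff_zero] using ha
  have hTB : IsUnit T := hT₁ ▸ hu₁.2.map φ₁
  have hTB' : IsUnit (C T) := hTB.map (C : B →+* B[X])
  let f₁ := X ^ (N + 2) + G₁ * e₁
  let ft := fun t => X ^ (N + 2) + G * e t
  let f' := X ^ (N + 2) + G' * e'
  have hf₁ : f₁.Monic := mon _ _ _ _ _
  have hft : ∀ t, (ft t).Monic := fun t => mon _ _ _ _ _
  have hf' : f'.Monic := mon _ _ _ _ _
  have hf₁c : IsCoprime f₁ (h.map (algebraMap A B₁)) := cop _ _ _ _ _ hσ₁ hu₁.2.neg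
  have hftc : ∀ t, IsCoprime (ft t) (h.map (algebraMap A B)) := fun t =>
    cop _ _ _ _ _ hσ' hTB.neg
  have hf'c : IsCoprime f' (h.map (algebraMap A B[X])) := cop _ _ _ _ _ hσ'' hTB'.neg
  have hfm : f.Monic := by
    refine (monic_X_sub_C T₀).of_mul_monic_left ?_
    rw [hf, ← C_neg]
    exact mon _ _ _ _ _
  -- Over D(sg) the coordinate T need not be invertible, so coprimality to Y comes from f(0) = 1
  -- instead. Coprimality to G is inherited from the multiple (Y - T) f.
  have hfc : IsCoprime f (h.map (algebraMap A B₀)) := by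
    rw [hh]
    refine isCoprime_map_of_isCoprime hs₀ (hgm σ₀ hσ₀)
      (isCoprime_X_of_isUnit_coeff_zero (by rw [hf0]; exact isUnit_one)) ?_
    have : IsCoprime ((X - C T₀) * f) G₀ := by
      rw [hf]
      exact isCoprime_X_pow_add (hc0 σ₀ hσ₀) _ _
    exact this.of_mul_left_right
  obtain ⟨r, hr⟩ : X - C T₀ ∣ 1 - f := by
    rw [dvd_iff_isRoot, IsRoot, eval_sub, hfT, eval_one, sub_self]
  have hfr : IsCoprime f r := ⟨1, X - C T₀, by rw [← hr]; ring⟩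
  let fB := f.map (φ₀ : B₀ →+* B)
  let rB := r.map (φ₀ : B₀ →+* B)
  have hfB : fB.Monic := hfm.map _
  have hfBr : IsCoprime fB rB := hfr.map (mapRingHom (φ₀ : B₀ →+* B))
  have hfBc : IsCoprime fB (h.map (algebraMap A B)) := by
    have := hfc.map (mapRingHom (φ₀ : B₀ →+* B))
    rwa [coe_mapRingHom, Polynomial.map_map, AlgHom.comp_algebraMap] at this
  -- The section b is the transfer of a along the zero locus of f₁ with the residue form, and c is
  -- the transfer along the zero locus of f with that form twisted by r.
  refine ⟨Sec.pull F (rootSpace h f₁ hf₁ hf₁c 1 isCoprime_one_right) a,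
    Sec.pull F (rootSpace h f hfm hfc r hfr) a, ?_⟩
  have h₁ : Sec.map F (φ₁.restrictScalars k)
      (Sec.pull F (rootSpace h f₁ hf₁ hf₁c 1 isCoprime_one_right) a) =
      Sec.pull F (rootSpace h (ft 0) (hft 0) (hftc 0) 1 isCoprime_one_right) a := by
    refine Sec.map_pull_rootSpace F φ₁ ?_ (Polynomial.map_one _).symm a
    simp only [ft, f₁, Polynomial.map_add, Polynomial.map_mul, hGφ₁]
    refine congrArg₂ (fun p q => p + G * q) (by simp) ?_
    simp [e₁, e, hT₁]
  have h₀ : Sec.map F (φ₀.restrictScalars k)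
      (Sec.pull F (rootSpace h f hfm hfc r hfr) a) =
      Sec.pull F (rootSpace h fB hfB hfBc rB hfBr) a :=
    Sec.map_pull_rootSpace F φ₀ rfl rfl a
  have h' : ∀ t, Sec.map F ((aeval t : B[X] →ₐ[B] B).restrictScalars k)
      (Sec.pull F (rootSpace h f' hf' hf'c 1 isCoprime_one_right) a) =
      Sec.pull F (rootSpace h (ft t) (hft t) (hftc t) 1 isCoprime_one_right) a := fun t => by
    refine Sec.map_pull_rootSpace F ((aeval t : B[X] →ₐ[B] B).restrictScalars A) ?_
      (Polynomial.map_one _).symm a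
    simp only [ft, f', Polynomial.map_add, Polynomial.map_mul, hGev]
    refine congrArg₂ (fun p q => p + G * q) (by simp) ?_
    simp [e', e, mul_comm (C t)]
  have hsplit := rootSpace_isometric_graph_sum (k := k) (h := h) (f₁ := ft 1) (f := fB) (r := rB)
    (T := T) (hf₁ := hft 1) (hh₁ := hftc 1) (hv₁ := isCoprime_one_right) (hf := hfB) (hh := hfBc)
    (hr := hfBr) (by
      have := congrArg (map (φ₀ : B₀ →+* B)) hf
      simp only [Polynomial.map_add, Polynomial.map_mul] at this
      simp only [ft, fB, ← hGφ₀]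
      simpa [e, hT₀, G₀] using this.symm) (by
      have := congrArg (map (φ₀ : B₀ →+* B)) hr
      simpa [hT₀, fB, rB] using this.symm) (AlgHom.id A B) rfl
  change Sec.map F (φ₁.restrictScalars k) _ = a + Sec.map F (φ₀.restrictScalars k) _
  -- On D(h), b is the transfer for t = 0. It equals the transfer for t = 1, which splits into the
  -- diagonal part a and the part c.
  rw [h₁, h₀, ← h' 0, Sec.map_aeval_eq F hF 0 1, h' 1, Sec.pull_isometric F hsplit, Sec.pull_sum,
    Sec.pull_graph]
  congr 1
  exact Sec.map_id F a

end Decomposition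

end WittTransfers

namespace WittTransfers

/-! ### Gluing sections on open subsets of an affine scheme -/

section Gluing

variable {k : Type u} [Field k] (F : (WCor k)ᵒᵖ ⥤ AddCommGrpCat.{w})
variable {R : Type u} [CommRing R] [Algebra k R]

theorem Sec.map_restrictScalars_injective {E E' : Type u} [CommRing E] [Algebra k E]
    [Algebra.Smooth k E] [Algebra R E] [IsScalarTower k R E] [CommRing E'] [Algebra k E']
    [Algebra.Smooth k E'] [Algebra R E'] [IsScalarTower k R E'] (θ : E ≃ₐ[R] E') :
    Function.Injective (Sec.map F ((θ : E →ₐ[R] E').restrictScalars k)) := by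
  refine Function.LeftInverse.injective
    (g := Sec.map F ((θ.symm : E' →ₐ[R] E).restrictScalars k)) fun x => ?_
  rw [Sec.map_map]
  convert Sec.map_id F x
  exact AlgHom.ext fun y => θ.symm_apply_apply y

theorem Sec.map_map_restrictScalars {E E' E'' : Type u} [CommRing E] [Algebra k E]
    [Algebra.Smooth k E] [Algebra R E] [IsScalarTower k R E] [CommRing E'] [Algebra k E']
    [Algebra.Smooth k E'] [Algebra R E'] [IsScalarTower k R E'] [CommRing E''] [Algebra k E'']
    [Algebra.Smooth k E''] [Algebra R E''] [IsScalarTower k R E''] (φ : E →ₐ[R] E')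
    (ψ : E' →ₐ[R] E'') (x : Sec F E) :
    Sec.map F (ψ.restrictScalars k) (Sec.map F (φ.restrictScalars k) x) =
      Sec.map F ((ψ.comp φ).restrictScalars k) x :=
  Sec.map_map F _ _ x

/-- The homomorphism of `R`-algebras `R_h → E` if `h` is invertible in `E`. -/
noncomputable def awayLift {E : Type*} [CommRing E] [Algebra R E] (h : R)
    (hh : IsUnit (algebraMap R E h)) : Localization.Away h →ₐ[R] E :=
  IsLocalization.Away.liftAlgHom h (f := Algebra.ofId R E) hh

theorem exists_awayLift_comp {S E : Type*} [CommRing S] [Algebra R S] [CommRing E] [Algebra R E]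
    (φ : S →ₐ[R] E) (t : S) (ht : IsUnit (φ t)) : ∃ θ : Localization.Away t →ₐ[R] E,
      θ.comp (IsScalarTower.toAlgHom R S (Localization.Away t)) = φ :=
  ⟨IsLocalization.Away.liftAlgHom t ht, AlgHom.ext fun z => IsLocalization.Away.lift_eq t ht z⟩

/-- Some multiple t f^n comes from an element a of R, and f is already invertible in R_f. Hence
(R_f)_t is the localization of R at af. -/
theorem exists_isLocalization_away (f : R) (t : Localization.Away f) :
    ∃ e : R, IsLocalization.Away e (Localization.Away t) := by
  obtain ⟨n, a, ha⟩ := IsLocalization.Away.surj f t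
  have hu : IsUnit (algebraMap R (Localization.Away f) f ^ n) :=
    (IsLocalization.Away.algebraMap_isUnit f).pow n
  have : IsLocalization.Away (algebraMap R (Localization.Away f) a) (Localization.Away t) :=
    IsLocalization.Away.of_associated (r := t) ⟨hu.unit, ha⟩
  exact ⟨a * f, IsLocalization.Away.mul (Localization.Away f) _ f a⟩

variable [Algebra.Smooth k R]

/-- A family of sections on principal open subsets `D (h)`, `h ∈ s`, that agree on intersections. -/
def IsCompatible {s : Set R} (x : ∀ h : s, Sec F (Localization.Away h.1)) : Prop :=
  ∀ (h h' : s) (e : R) (φ : Localization.Away h.1 →ₐ[R] Localization.Away e)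
    (ψ : Localization.Away h'.1 →ₐ[R] Localization.Away e),
    Sec.map F (φ.restrictScalars k) (x h) = Sec.map F (ψ.restrictScalars k) (x h')

variable {F}

/-- Compatibility extends to any model E of the localization. The sheaf axiom over R_f yields
iterated localizations (R_f)_t, which are only isomorphic to some R_e. -/
theorem IsCompatible.map_eq {s : Set R} {x : ∀ h : s, Sec F (Localization.Away h.1)}
    (hx : IsCompatible F x) {E : Type u} [CommRing E] [Algebra k E]
    [Algebra.Smooth k E] [Algebra R E] [IsScalarTower k R E] (e : R) [IsLocalization.Away e E]
    (h h' : s) (φ : Localization.Away h.1 →ₐ[R] E) (ψ : Localization.Away h'.1 →ₐ[R] E) :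
    Sec.map F (φ.restrictScalars k) (x h) = Sec.map F (ψ.restrictScalars k) (x h') := by
  let θ : E ≃ₐ[R] Localization.Away e := IsLocalization.algEquiv (Submonoid.powers e) _ _
  apply Sec.map_restrictScalars_injective F θ
  rw [Sec.map_map_restrictScalars, Sec.map_map_restrictScalars]
  exact hx h h' e _ _

/-- The images in R_f of the elements of s generate the unit ideal, so the sheaf axiom applies to
Spec R_f. The sets D(h) need not lie in D(f); the resulting section is characterized on all
principal opens inside both. -/
theorem IsCompatible.existsUnique (hF : IsZariskiSheaf F) {s : Set R}
    {x : ∀ h : s, Sec F (Localization.Away h.1)} (hx : IsCompatible F x) (f : R)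
    (hf : ∀ q : PrimeSpectrum R, f ∉ q.asIdeal → ∃ h ∈ s, h ∉ q.asIdeal) :
    ∃! y : Sec F (Localization.Away f), ∀ (h : s) (e : R)
      (φ : Localization.Away f →ₐ[R] Localization.Away e)
      (ψ : Localization.Away h.1 →ₐ[R] Localization.Away e),
      Sec.map F (φ.restrictScalars k) y = Sec.map F (ψ.restrictScalars k) (x h) := by
  let S := Localization.Away f
  let t : Set S := algebraMap R S '' s
  have ht : Ideal.span t = ⊤ := by
    by_contra h
    obtain ⟨m, hm, hle⟩ := Ideal.exists_le_maximal _ h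
    obtain ⟨h, hs, hh⟩ := hf (PrimeSpectrum.comap (algebraMap R S) ⟨m, hm.isPrime⟩) fun hfm =>
      hm.ne_top (Ideal.eq_top_of_isUnit_mem m hfm (IsLocalization.Away.algebraMap_isUnit f))
    exact hh (hle (Ideal.subset_span ⟨h, hs, rfl⟩))
  -- Several elements of s may have the same image in R_f. The choice of a preimage is harmless
  -- because the family is compatible.
  choose c hcs hc using fun a : t => a.2
  have hlift : ∀ a : t, IsUnit (algebraMap R (Localization.Away a.1) (c a)) := fun a => by
    rw [IsScalarTower.algebraMap_apply R S, hc]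
    exact IsLocalization.Away.algebraMap_isUnit _
  let X : ∀ a : t, Sec F (Localization.Away a.1) := fun a =>
    Sec.map F ((awayLift (c a) (hlift a)).restrictScalars k) (x ⟨c a, hcs a⟩)
  have hX : ∀ (a b : t) (h : S) (φ : Localization.Away a.1 →ₐ[S] Localization.Away h)
      (ψ : Localization.Away b.1 →ₐ[S] Localization.Away h),
      Sec.map F (φ.restrictScalars k) (X a) = Sec.map F (ψ.restrictScalars k) (X b) := by
    intro a b h φ ψ
    obtain ⟨e, he⟩ := exists_isLocalization_away f h
    have e₁ : φ.restrictScalars k = (φ.restrictScalars R).restrictScalars k := rfl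
    have e₂ : ψ.restrictScalars k = (ψ.restrictScalars R).restrictScalars k := rfl
    rw [e₁, e₂]
    have h₁ := Sec.map_map_restrictScalars F (awayLift (c a) (hlift a)) (φ.restrictScalars R)
      (x ⟨c a, hcs a⟩)
    have h₂ := Sec.map_map_restrictScalars F (awayLift (c b) (hlift b)) (ψ.restrictScalars R)
      (x ⟨c b, hcs b⟩)
    have h₃ := hx.map_eq e ⟨c a, hcs a⟩ ⟨c b, hcs b⟩
      ((φ.restrictScalars R).comp (awayLift (c a) (hlift a)))
      ((ψ.restrictScalars R).comp (awayLift (c b) (hlift b)))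
    exact h₁.trans (h₃.trans h₂.symm)
  obtain ⟨y, hy, huniq⟩ := hF S t ht X hX
  refine ⟨y, fun h e φ ψ => ?_, fun y' hy' => huniq y' fun a => ?_⟩
  · let a : t := ⟨algebraMap R S h, h, h.2, rfl⟩
    have hu : IsUnit (φ a.1) := by
      rw [φ.commutes, ← ψ.commutes]
      exact (IsLocalization.Away.algebraMap_isUnit h.1).map ψ
    obtain ⟨θ, hθ⟩ := exists_awayLift_comp φ a.1 hu
    have h₀ := Sec.map_map_restrictScalars F (IsScalarTower.toAlgHom R S (Localization.Away a.1)) θ y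
    rw [hθ] at h₀
    rw [← h₀]
    have h₁ := Sec.map_map_restrictScalars F (awayLift (c a) (hlift a)) θ (x ⟨c a, hcs a⟩)
    have h₂ := hx ⟨c a, hcs a⟩ h e (θ.comp (awayLift (c a) (hlift a))) ψ
    have h₃ : Sec.map F ((IsScalarTower.toAlgHom R S (Localization.Away a.1)).restrictScalars k) y =
        X a := hy a
    rw [h₃]
    exact h₁.trans h₂
  · obtain ⟨e, he⟩ := exists_isLocalization_away f a.1
    let θ : Localization.Away a.1 ≃ₐ[R] Localization.Away e :=
      IsLocalization.algEquiv (Submonoid.powers e) _ _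
    apply Sec.map_restrictScalars_injective F θ
    let θ' : Localization.Away a.1 →ₐ[R] Localization.Away e := θ
    have h₁ := Sec.map_map_restrictScalars F (IsScalarTower.toAlgHom R S (Localization.Away a.1))
      θ' y'
    have h₂ := Sec.map_map_restrictScalars F (awayLift (c a) (hlift a)) θ' (x ⟨c a, hcs a⟩)
    have h₃ := hy' ⟨c a, hcs a⟩ e
      (θ'.comp (IsScalarTower.toAlgHom R S _)) (θ'.comp (awayLift (c a) (hlift a)))
    exact h₁.trans (h₃.trans h₂.symm)

/-- A compatible family of sections on the principal open subsets in a covering of `W` glues. -/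
theorem IsCompatible.exists_openSec (hF : IsZariskiSheaf F) {s : Set R}
    {x : ∀ h : s, Sec F (Localization.Away h.1)} (hx : IsCompatible F x)
    (W : Opens (PrimeSpectrum R)) (hs : ∀ h ∈ s, PrimeSpectrum.basicOpen h ≤ W)
    (hW : ∀ q ∈ W, ∃ h ∈ s, h ∉ q.asIdeal) :
    ∃ y : openSec F R W, ∀ h : s, y.1 ⟨h.1, hs h.1 h.2⟩ = x h := by
  have key := fun f : {f : R // PrimeSpectrum.basicOpen f ≤ W} =>
    hx.existsUnique hF f.1 fun q hq => hW q (f.2 hq)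
  choose y hy huniq using key
  refine ⟨⟨y, fun f g φ => ?_⟩, fun h => ?_⟩
  -- The restriction of the section on D(f) to D(g) has the property that characterizes the section
  -- on D(g).
  · refine huniq g _ fun h e φ' ψ => ?_
    rw [Sec.map_map_restrictScalars]
    exact hy f h e _ ψ
  · exact (huniq ⟨h.1, hs h.1 h.2⟩ (x h) fun h' e φ ψ => hx h h' e φ ψ).symm

/-- Sections on `W₁` and on `W₂` that agree on `W₁ ∩ W₂` glue. -/
theorem openSec.exists_glue (hF : IsZariskiSheaf F) {W₁ W₂ : Opens (PrimeSpectrum R)}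
    (x₁ : openSec F R W₁) (x₂ : openSec F R W₂)
    (hx : openSec.res F R (inf_le_left : W₁ ⊓ W₂ ≤ W₁) x₁ =
      openSec.res F R (inf_le_right : W₁ ⊓ W₂ ≤ W₂) x₂) :
    ∃ y : openSec F R (W₁ ⊔ W₂), openSec.res F R le_sup_left y = x₁ ∧
      openSec.res F R le_sup_right y = x₂ := by
  classical
  have hx' : ∀ f (h₁ : PrimeSpectrum.basicOpen f ≤ W₁) (h₂ : PrimeSpectrum.basicOpen f ≤ W₂),
      x₁.1 ⟨f, h₁⟩ = x₂.1 ⟨f, h₂⟩ := fun f h₁ h₂ =>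
    congrFun (congrArg Subtype.val hx) ⟨f, le_inf h₁ h₂⟩
  let s : Set R := {h | PrimeSpectrum.basicOpen h ≤ W₁ ∨ PrimeSpectrum.basicOpen h ≤ W₂}
  -- When D(h) lies in both opens the value is taken from x₁. By `hx'` the other choice gives the
  -- same section.
  let x : ∀ h : s, Sec F (Localization.Away h.1) := fun h =>
    if h₁ : PrimeSpectrum.basicOpen h.1 ≤ W₁ then x₁.1 ⟨h.1, h₁⟩
    else x₂.1 ⟨h.1, h.2.resolve_left h₁⟩
  have e₁ : ∀ h (h₁ : PrimeSpectrum.basicOpen h ≤ W₁), x ⟨h, .inl h₁⟩ = x₁.1 ⟨h, h₁⟩ :=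
    fun h h₁ => dif_pos h₁
  have e₂ : ∀ h (h₂ : PrimeSpectrum.basicOpen h ≤ W₂), x ⟨h, .inr h₂⟩ = x₂.1 ⟨h, h₂⟩ := by
    intro h h₂
    by_cases h₁ : PrimeSpectrum.basicOpen h ≤ W₁
    · exact (e₁ h h₁).trans (hx' h h₁ h₂)
    · exact dif_neg h₁
  have hle : ∀ {h e : R}, (Localization.Away h →ₐ[R] Localization.Away e) →
      PrimeSpectrum.basicOpen e ≤ PrimeSpectrum.basicOpen h := fun {h e} φ => by
    rw [PrimeSpectrum.basicOpen_le_basicOpen_iff_algebraMap_isUnit (S := Localization.Away e),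
      ← φ.commutes]
    exact (IsLocalization.Away.algebraMap_isUnit h).map φ
  have hcomp : IsCompatible F x := by
    rintro ⟨h, h₁ | h₂⟩ ⟨h', h₁' | h₂'⟩ e φ ψ
    · rw [e₁ h h₁, e₁ h' h₁', x₁.2 ⟨h, h₁⟩ ⟨e, (hle φ).trans h₁⟩ φ,
        x₁.2 ⟨h', h₁'⟩ ⟨e, (hle φ).trans h₁⟩ ψ]
    · rw [e₁ h h₁, e₂ h' h₂', x₁.2 ⟨h, h₁⟩ ⟨e, (hle φ).trans h₁⟩ φ,
        x₂.2 ⟨h', h₂'⟩ ⟨e, (hle ψ).trans h₂'⟩ ψ, hx']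
    · rw [e₂ h h₂, e₁ h' h₁', x₂.2 ⟨h, h₂⟩ ⟨e, (hle φ).trans h₂⟩ φ,
        x₁.2 ⟨h', h₁'⟩ ⟨e, (hle ψ).trans h₁'⟩ ψ, hx']
    · rw [e₂ h h₂, e₂ h' h₂', x₂.2 ⟨h, h₂⟩ ⟨e, (hle φ).trans h₂⟩ φ,
        x₂.2 ⟨h', h₂'⟩ ⟨e, (hle φ).trans h₂⟩ ψ]
  obtain ⟨y, hy⟩ := hcomp.exists_openSec hF (W₁ ⊔ W₂)
    (fun h hh => hh.elim (fun h₁ => h₁.trans le_sup_left) fun h₂ => h₂.trans le_sup_right) (by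
      have hb : ∀ (W : Opens (PrimeSpectrum R)), ∀ q ∈ W, ∃ h : R,
          PrimeSpectrum.basicOpen h ≤ W ∧ h ∉ q.asIdeal := fun W q hq => by
        obtain ⟨_, ⟨h, rfl⟩, hqh, hle⟩ :=
          PrimeSpectrum.isTopologicalBasis_basic_opens.exists_subset_of_mem_open hq W.isOpen
        exact ⟨h, hle, hqh⟩
      rintro q (hq | hq)
      · obtain ⟨h, h1, h2⟩ := hb W₁ q hq
        exact ⟨h, .inl h1, h2⟩
      · obtain ⟨h, h1, h2⟩ := hb W₂ q hq
        exact ⟨h, .inr h1, h2⟩)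
  refine ⟨y, Subtype.ext (funext fun f => ?_), Subtype.ext (funext fun f => ?_)⟩
  · exact (hy ⟨f.1, .inl f.2⟩).trans (e₁ f.1 f.2)
  · exact (hy ⟨f.1, .inr f.2⟩).trans (e₂ f.1 f.2)

end Gluing
end WittTransfers

namespace WittTransfers

/-! ### Spreading out and gluing germs on localizations -/

section Germs

variable {k : Type u} [Field k] (F : (WCor k)ᵒᵖ ⥤ AddCommGrpCat.{w})
variable {R : Type u} [CommRing R] [Algebra k R] [Algebra.Smooth k R] {S : Type u} [CommRing S]

theorem openSec.res_res {W W' W'' : Opens (PrimeSpectrum R)} (h : W' ≤ W) (h' : W'' ≤ W')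
    (x : openSec F R W) :
    openSec.res F R h' (openSec.res F R h x) = openSec.res F R (h'.trans h) x := rfl

theorem Germ.exists_res_eq_zero (j : R →+* S) {V : Opens (PrimeSpectrum S)}
    {W : Opens (PrimeSpectrum R)} (hW : ∀ x ∈ V, PrimeSpectrum.comap j x ∈ W) (x : openSec F R W)
    (hx : Germ.of F j W hW x = 0) :
    ∃ (W' : Opens (PrimeSpectrum R)) (_ : ∀ x ∈ V, PrimeSpectrum.comap j x ∈ W') (h : W' ≤ W),
      openSec.res F R h x = 0 := by
  classical
  have : DirectedSystem (fun W : OpenNhd j V => openSec F R (OrderDual.ofDual W).1)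
      (fun _ _ h => ⇑(openSec.res F R h)) := ⟨fun _ _ => rfl, fun _ _ _ _ _ _ => rfl⟩
  obtain ⟨W', h, h'⟩ := @AddCommGroup.DirectLimit.of.zero_exact (OpenNhd j V) _
    (fun W : OpenNhd j V => openSec F R (OrderDual.ofDual W).1) _
    (fun _ _ h => openSec.res F R h) _ _ this (OrderDual.toDual ⟨W, hW⟩) x hx
  exact ⟨(OrderDual.ofDual W').1, (OrderDual.ofDual W').2, h, h'⟩

/-- An inclusion of opens that holds on Spec M⁻¹R already holds on some D(s) with s in M. As W is
quasi-compact, it suffices to treat W = D(a). If no s worked, the ideal of the complement of W'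
would miss all products s a^n. A prime containing it and avoiding these products would then be a
point of Spec M⁻¹R in W but not in W'. -/
theorem exists_basicOpen_inf_le [IsNoetherianRing R] [Algebra R S] (M : Submonoid R)
    [IsLocalization M S] (W W' : Opens (PrimeSpectrum R))
    (h : ∀ y, PrimeSpectrum.comap (algebraMap R S) y ∈ W →
      PrimeSpectrum.comap (algebraMap R S) y ∈ W') :
    ∃ s ∈ M, PrimeSpectrum.basicOpen s ⊓ W ≤ W' := by
  obtain ⟨t, ht⟩ := PrimeSpectrum.isCompact_isOpen_iff.1
    ⟨TopologicalSpace.NoetherianSpace.isCompact (W : Set (PrimeSpectrum R)), W.isOpen⟩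
  obtain ⟨I, hI⟩ := (PrimeSpectrum.isOpen_iff _).1 W'.isOpen
  have hW : ∀ q, q ∈ W ↔ ∃ a ∈ t, a ∉ q.asIdeal := fun q => by
    rw [← SetLike.mem_coe, ← ht]
    simp [PrimeSpectrum.mem_zeroLocus, Set.subset_def]
  have hW' : ∀ q, q ∈ W' ↔ ¬ I ⊆ q.asIdeal := fun q => by
    rw [← PrimeSpectrum.mem_zeroLocus, ← hI]
    simp
  have key : ∀ a ∈ t, ∃ s ∈ M, ∀ q : PrimeSpectrum R, s ∉ q.asIdeal → a ∉ q.asIdeal → q ∈ W' := by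
    intro a ha
    by_contra! hcon
    have hdisj : Disjoint (Ideal.span I : Set R) (M ⊔ Submonoid.powers a : Submonoid R) := by
      rw [Set.disjoint_left]
      rintro r hr hr'
      obtain ⟨s, hs, _, ⟨n, rfl⟩, rfl⟩ := Submonoid.mem_sup.1 hr'
      obtain ⟨q, hsq, haq, hq⟩ := hcon s hs
      rw [hW', not_not] at hq
      rcases q.2.mem_or_mem (Ideal.span_le.2 hq hr) with h | h
      · exact hsq h
      · exact haq (q.2.mem_of_pow_mem _ h)
    obtain ⟨q, hq, hle, hd⟩ := Ideal.exists_le_prime_disjoint _ _ hdisj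
    have hqM : Disjoint (M : Set R) q := 
      (Set.disjoint_of_subset_right (SetLike.coe_subset_coe.2 le_sup_left) hd).symm
    obtain ⟨y, hy⟩ : (⟨q, hq⟩ : PrimeSpectrum R) ∈
        Set.range (PrimeSpectrum.comap (algebraMap R S)) := by
      rw [PrimeSpectrum.localization_comap_range S M]
      exact hqM
    have hqW : PrimeSpectrum.comap (algebraMap R S) y ∈ W := by
      rw [hy, hW]
      exact ⟨a, ha, fun h => Set.disjoint_left.1 hd h
        (Submonoid.mem_sup_right (Submonoid.mem_powers a))⟩
    have := h y hqW
    rw [hy, hW'] at this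
    exact this (Ideal.span_le.1 hle)
  choose! s hsM hs using key
  -- The product over the finitely many a defines the intersection of the opens D(s a).
  refine ⟨∏ a ∈ t, s a, prod_mem hsM, fun q hq => ?_⟩
  obtain ⟨a, ha, haq⟩ := (hW q).1 hq.2
  refine hs a ha q (fun h => hq.1 ?_) haq
  exact Ideal.mem_of_dvd _ (Finset.dvd_prod_of_mem s ha) h

variable {F}

/-- Germs on `V₁` and on `V₂` that agree on `V₁ ∩ V₂` glue. -/
theorem Germ.exists_glue (hF : IsZariskiSheaf F) [IsNoetherianRing R] [Algebra R S]
    (M : Submonoid R) [IsLocalization M S] {V₁ V₂ : Opens (PrimeSpectrum S)}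
    (x₁ : Germ F (algebraMap R S) V₁) (x₂ : Germ F (algebraMap R S) V₂)
    (hx : Germ.res F (algebraMap R S) (inf_le_left : V₁ ⊓ V₂ ≤ V₁) x₁ =
      Germ.res F (algebraMap R S) (inf_le_right : V₁ ⊓ V₂ ≤ V₂) x₂) :
    ∃ y : Germ F (algebraMap R S) (V₁ ⊔ V₂),
      Germ.res F (algebraMap R S) le_sup_left y = x₁ ∧
      Germ.res F (algebraMap R S) le_sup_right y = x₂ := by
  obtain ⟨W₁, hW₁, x₁, rfl⟩ := Germ.exists_of F _ x₁
  obtain ⟨W₂, hW₂, x₂, rfl⟩ := Germ.exists_of F _ x₂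
  have hW : ∀ x ∈ V₁ ⊓ V₂, PrimeSpectrum.comap (algebraMap R S) x ∈ W₁ ⊓ W₂ :=
    fun x hx => ⟨hW₁ x hx.1, hW₂ x hx.2⟩
  obtain ⟨W₃, hW₃, h₃, hx₃⟩ := Germ.exists_res_eq_zero F (algebraMap R S) hW
    (openSec.res F R inf_le_left x₁ - openSec.res F R inf_le_right x₂) (by
      rw [map_sub, Germ.of_res F (algebraMap R S) (V := V₁ ⊓ V₂) (W := W₁) (fun x h => hW₁ x h.1),
        Germ.of_res F (algebraMap R S) (V := V₁ ⊓ V₂) (W := W₂) (fun x h => hW₂ x h.2), sub_eq_zero]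
      rwa [Germ.res_of, Germ.res_of] at hx)
  rw [map_sub, sub_eq_zero, openSec.res_res, openSec.res_res] at hx₃
  -- The opens V₁, V₂ are traces of opens O₁, O₂ of Spec R. Cutting W₁, W₂ down to these ensures
  -- that W₁ ∩ W₂ has trace inside V₁ ∩ V₂, hence inside W₃.
  obtain ⟨O₁, hO₁, hV₁⟩ := (PrimeSpectrum.localization_comap_isInducing S M).isOpen_iff.1 V₁.isOpen
  obtain ⟨O₂, hO₂, hV₂⟩ := (PrimeSpectrum.localization_comap_isInducing S M).isOpen_iff.1 V₂.isOpen
  have hV₁' : ∀ y, y ∈ V₁ ↔ PrimeSpectrum.comap (algebraMap R S) y ∈ O₁ := fun y => by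
    rw [← SetLike.mem_coe, ← hV₁]; rfl
  have hV₂' : ∀ y, y ∈ V₂ ↔ PrimeSpectrum.comap (algebraMap R S) y ∈ O₂ := fun y => by
    rw [← SetLike.mem_coe, ← hV₂]; rfl
  -- Shrinking to D(s), which contains the whole image of Spec S, turns inclusion of traces into
  -- inclusion. The representatives then agree on the full intersection of their domains.
  obtain ⟨s, hs, hsW⟩ := exists_basicOpen_inf_le (S := S) M
    ((W₁ ⊓ ⟨O₁, hO₁⟩) ⊓ (W₂ ⊓ ⟨O₂, hO₂⟩)) W₃
    fun y hy => hW₃ y ⟨(hV₁' y).2 hy.1.2, (hV₂' y).2 hy.2.2⟩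
  have hsy : ∀ y : PrimeSpectrum S,
      PrimeSpectrum.comap (algebraMap R S) y ∈ PrimeSpectrum.basicOpen s := fun y hy =>
    y.2.ne_top (Ideal.eq_top_of_isUnit_mem _ hy (IsLocalization.map_units S ⟨s, hs⟩))
  let W₁' := PrimeSpectrum.basicOpen s ⊓ (W₁ ⊓ ⟨O₁, hO₁⟩)
  let W₂' := PrimeSpectrum.basicOpen s ⊓ (W₂ ⊓ ⟨O₂, hO₂⟩)
  have h₁ : W₁' ≤ W₁ := inf_le_right.trans inf_le_left
  have h₂ : W₂' ≤ W₂ := inf_le_right.trans inf_le_left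
  have h₁₂ : W₁' ⊓ W₂' ≤ W₃ := fun q hq => hsW ⟨hq.1.1, hq.1.2, hq.2.2⟩
  have hn₁ : ∀ y ∈ V₁, PrimeSpectrum.comap (algebraMap R S) y ∈ W₁' := fun y hy =>
    ⟨hsy y, hW₁ y hy, (hV₁' y).1 hy⟩
  have hn₂ : ∀ y ∈ V₂, PrimeSpectrum.comap (algebraMap R S) y ∈ W₂' := fun y hy =>
    ⟨hsy y, hW₂ y hy, (hV₂' y).1 hy⟩
  obtain ⟨y, hy₁, hy₂⟩ := openSec.exists_glue hF (openSec.res F R h₁ x₁) (openSec.res F R h₂ x₂)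
    (congrArg (openSec.res F R h₁₂) hx₃)
  have hn : ∀ y ∈ V₁ ⊔ V₂, PrimeSpectrum.comap (algebraMap R S) y ∈ W₁' ⊔ W₂' := fun y hy =>
    hy.elim (fun h => .inl (hn₁ y h)) fun h => .inr (hn₂ y h)
  refine ⟨Germ.of F _ (W₁' ⊔ W₂') hn y, ?_, ?_⟩
  · rw [Germ.res_of, ← Germ.of_res F (algebraMap R S) _ hn₁ le_sup_left, hy₁, Germ.of_res]
  · rw [Germ.res_of, ← Germ.of_res F (algebraMap R S) _ hn₂ le_sup_right, hy₂, Germ.of_res]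

variable (F) in
/-- The section on the principal open subset `D (e)` given by an element of `F (Spec R_e)`. -/
noncomputable def openSec.ofSec (e : R) (x : Sec F (Localization.Away e)) :
    openSec F R (PrimeSpectrum.basicOpen e) :=
  ⟨fun f => Sec.map F ((awayLift (E := Localization.Away f.1) e <|
      (PrimeSpectrum.basicOpen_le_basicOpen_iff_algebraMap_isUnit
        (S := Localization.Away f.1)).1 f.2).restrictScalars k) x,
    fun f g (φ : Localization.Away f.1 →ₐ[R] Localization.Away g.1) => by
      rw [Sec.map_map_restrictScalars]
      exact congrArg (fun θ : Localization.Away e →ₐ[R] Localization.Away g.1 =>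
        Sec.map F (θ.restrictScalars k) x)
        ((IsLocalization.algHom_subsingleton (Submonoid.powers e)).elim _ _)⟩

theorem openSec.ofSec_apply (e : R) (x : Sec F (Localization.Away e))
    (f : {f : R // PrimeSpectrum.basicOpen f ≤ PrimeSpectrum.basicOpen e})
    (φ : Localization.Away e →ₐ[R] Localization.Away f.1) :
    (openSec.ofSec F e x).1 f = Sec.map F (φ.restrictScalars k) x := by
  have : φ = awayLift e ((PrimeSpectrum.basicOpen_le_basicOpen_iff_algebraMap_isUnit
        (S := Localization.Away f.1)).1 f.2) :=
    (IsLocalization.algHom_subsingleton (Submonoid.powers e)).elim _ _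
  rw [this]
  rfl

end Germs
end WittTransfers

namespace WittTransfers

open Polynomial

/-! ### Excision on the affine line over a local scheme -/

section Excision

attribute [local instance] Polynomial.algebra Polynomial.isLocalization

variable {k : Type u} [Field k] {F : (WCor k)ᵒᵖ ⥤ AddCommGrpCat.{w}}
  {A : Type u} [CommRing A] [Algebra k A] [Algebra.Smooth k A] {p : Ideal A} [p.IsPrime]

theorem isNoetherianRing_polynomial_of_smooth (k A : Type u) [Field k] [CommRing A] [Algebra k A]
    [Algebra.Smooth k A] : IsNoetherianRing A[X] :=
  have : IsNoetherianRing A := Algebra.FiniteType.isNoetherianRing k A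
  inferInstance

/-- Germs on two open subsets of `𝔸¹_U` that agree on the intersection glue. -/
theorem Germ.exists_glue_lineMap (hF : IsZariskiSheaf F)
    {V V₁ V₂ : Opens (PrimeSpectrum (LineRing A p))} (hV : V ≤ V₁ ⊔ V₂) (h₁ : V₁ ≤ V) (h₂ : V₂ ≤ V)
    (x₁ : Germ F (lineMap A p) V₁) (x₂ : Germ F (lineMap A p) V₂)
    (hx : Germ.res F (lineMap A p) (inf_le_left : V₁ ⊓ V₂ ≤ V₁) x₁ =
      Germ.res F (lineMap A p) (inf_le_right : V₁ ⊓ V₂ ≤ V₂) x₂) :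
    ∃ y : Germ F (lineMap A p) V, Germ.res F (lineMap A p) h₁ y = x₁ ∧
      Germ.res F (lineMap A p) h₂ y = x₂ := by
  have := isNoetherianRing_polynomial_of_smooth k A
  obtain rfl : V = V₁ ⊔ V₂ := le_antisymm hV (sup_le h₁ h₂)
  -- The ring of 𝔸¹_U is the localization of A[T] at the constants from the complement of p.
  exact Germ.exists_glue hF (p.primeCompl.map C) x₁ x₂ hx

theorem puncture_sup_eq {V V' : Opens (PrimeSpectrum (LineRing A p))}
    (hV' : zeroSection A p ⊆ V') : V ≤ puncture V ⊔ V' := fun q hq => by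
  by_cases h : q ∈ zeroSection A p
  · exact .inr (hV' h)
  · exact .inl ⟨hq, h⟩

/-- If the restriction of x to V' - 0 extends to y on V', then x and y agree on (V - 0) ∩ V' and
glue to an extension of x to V. Transfers play no role here. -/
theorem PairSec.res_injective (hF : IsZariskiSheaf F) {V V' : Opens (PrimeSpectrum (LineRing A p))}
    (h : V' ≤ V) (hV' : zeroSection A p ⊆ V') : Function.Injective (PairSec.res F A p h) := by
  rw [injective_iff_map_eq_zero]
  intro z hz
  obtain ⟨x, rfl⟩ := QuotientAddGroup.mk_surjective z
  obtain ⟨y, hy⟩ := (QuotientAddGroup.eq_zero_iff _).1 hz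
  refine (QuotientAddGroup.eq_zero_iff _).2 ?_
  have hle : puncture V ⊓ V' ≤ puncture V' := fun q hq => ⟨hq.2, hq.1.2⟩
  obtain ⟨c, hc, -⟩ := Germ.exists_glue_lineMap hF (puncture_sup_eq hV') (puncture_le V) h x y (by
    have := congrArg (Germ.res F (lineMap A p) hle) hy
    rw [Germ.res_res, Germ.res_res] at this
    exact this.symm)
  exact ⟨c, hc⟩

/-- A neighbourhood of the zero section contains a principal open neighbourhood that is defined over
`A`. -/
theorem exists_basicOpen_le_of_zeroSection {V : Opens (PrimeSpectrum (LineRing A p))}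
    (hV : zeroSection A p ⊆ V) : ∃ g : A[X], g.coeff 0 ∉ p ∧
      PrimeSpectrum.basicOpen (lineMap A p g) ≤ V := by
  obtain ⟨I, hI⟩ := (PrimeSpectrum.isOpen_iff _).1 V.isOpen
  -- The complement of V and the zero section are disjoint closed subsets, so their ideals are
  -- comaximal. Some v in the ideal of the complement therefore has constant coefficient 1, and
  -- clearing its denominators by s gives g.
  have htop : Ideal.span I ⊔ Ideal.span {(X : LineRing A p)} = ⊤ := by
    by_contra hne
    obtain ⟨m, hm, hle⟩ := Ideal.exists_le_maximal _ hne
    rw [sup_le_iff, Ideal.span_le, Ideal.span_le] at hle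
    have h1 : (⟨m, hm.isPrime⟩ : PrimeSpectrum _) ∈ V := hV hle.2
    have h2 : (⟨m, hm.isPrime⟩ : PrimeSpectrum _) ∈ (V : Set _)ᶜ := by
      rw [hI]; exact hle.1
    exact h2 h1
  obtain ⟨v, hv, w, hw, hvw⟩ := Submodule.mem_sup.1 ((Ideal.eq_top_iff_one _).1 htop)
  obtain ⟨w, rfl⟩ := Ideal.mem_span_singleton'.1 hw
  have hv0 : v.coeff 0 = 1 := by
    have := congrArg (coeff · 0) hvw
    simpa [mul_coeff_zero] using this
  obtain ⟨⟨g, ⟨_, s, hs, rfl⟩⟩, hg⟩ := IsLocalization.surj (p.primeCompl.map C) v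
  change v * lineMap A p (C s) = lineMap A p g at hg
  refine ⟨g, fun hgp => ?_, fun q hq => ?_⟩
  · have h0 : algebraMap A (Localization.AtPrime p) s = algebraMap A _ (g.coeff 0) := by
      have := congrArg (coeff · 0) hg
      simpa [mul_coeff_zero, hv0] using this
    have hu := IsLocalization.map_units (Localization.AtPrime p) (⟨s, hs⟩ : p.primeCompl)
    rw [show ((⟨s, hs⟩ : p.primeCompl) : A) = s from rfl, h0,
      IsLocalization.AtPrime.isUnit_to_map_iff _ p] at hu
    exact hu hgp
  · by_contra hqV
    have : q ∈ (V : Set _)ᶜ := hqV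
    rw [hI] at this
    refine hq ?_
    rw [← hg]
    exact Ideal.mul_mem_right _ _ (Ideal.span_le.2 this hv)

theorem lineMap_C_notMem {s : A} (hs : s ∉ p) (y : PrimeSpectrum (LineRing A p)) :
    lineMap A p (C s) ∉ y.asIdeal := fun h =>
  y.2.ne_top (Ideal.eq_top_of_isUnit_mem _ h
    (IsLocalization.map_units (LineRing A p) (⟨C s, s, hs, rfl⟩ : p.primeCompl.map C)))

/-- On the zero section g takes the value g(0), which is a unit of the local ring. -/
theorem zeroSection_subset_basicOpen {g : A[X]} (hg : g.coeff 0 ∉ p) :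
    zeroSection A p ⊆ PrimeSpectrum.basicOpen (lineMap A p g) := fun y hy h => by
  refine lineMap_C_notMem hg y ?_
  have hX : (X : LineRing A p) ∈ y.asIdeal := hy rfl
  have e : lineMap A p (C (g.coeff 0)) = lineMap A p g - lineMap A p g.divX * X := by
    conv_rhs => enter [1]; rw [← g.divX_mul_X_add]
    simp
  rw [e]
  exact sub_mem h (Ideal.mul_mem_left _ _ hX)

/-- After spreading out, a section x on V - 0 restricts to b - c on V' - 0, with b on 𝔸¹_U - 0 and c
on V'. The sections b - x on V - 0 and c on V' then glue to a section on V, so b represents the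
class of x. -/
theorem PairSec.res_surjective [F.Additive] (hF : IsZariskiSheaf F) (hF' : IsHomotopyInvariant F)
    {V : Opens (PrimeSpectrum (LineRing A p))} (hV : zeroSection A p ⊆ V) :
    Function.Surjective (PairSec.res F A p (le_top : V ≤ ⊤)) := by
  have := isNoetherianRing_polynomial_of_smooth k A
  intro z
  obtain ⟨z, rfl⟩ := QuotientAddGroup.mk_surjective z
  obtain ⟨W, hW, x, rfl⟩ := Germ.exists_of F _ z
  obtain ⟨g₀, hg₀, hg₀V⟩ := exists_basicOpen_le_of_zeroSection hV
  -- The punctured open D(T g₀) lies in the domain of x only over U. Inverting a suitable s₀ outside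
  -- p makes this true over A. Replacing g₀ by s₀ g₀ absorbs s₀ and keeps the constant coefficient
  -- outside p.
  obtain ⟨_, ⟨s₀, hs₀, rfl⟩, hsW⟩ := exists_basicOpen_inf_le (S := LineRing A p)
    (p.primeCompl.map C) (PrimeSpectrum.basicOpen (X * g₀)) W fun y hy => hW y <| by
      have hy' : lineMap A p (X * g₀) ∉ y.asIdeal := hy
      rw [map_mul] at hy'
      refine ⟨hg₀V fun h => hy' (Ideal.mul_mem_left _ _ h), fun h => hy' ?_⟩
      have hX : lineMap A p X ∈ y.asIdeal := by
        rw [show lineMap A p X = X from map_X _]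
        exact h rfl
      exact Ideal.mul_mem_right _ _ hX
  set g := C s₀ * g₀ with hg
  set s := g.coeff 0 with hs
  have hsp : s ∉ p := by
    rw [hs, hg, coeff_C_mul]
    exact p.primeCompl.mul_mem hs₀ hg₀
  have hmem : ∀ (q : PrimeSpectrum A[X]) (a b : A[X]),
      a * b ∉ q.asIdeal ↔ a ∉ q.asIdeal ∧ b ∉ q.asIdeal := fun q a b => by
    rw [q.2.mul_mem_iff_mem_or_mem, not_or]
  let h : A[X] := C s * X * g
  have hhW : PrimeSpectrum.basicOpen h ≤ W := fun q hq => by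
    obtain ⟨h1, h2⟩ := (hmem _ _ _).1 hq
    obtain ⟨-, h1⟩ := (hmem _ _ _).1 h1
    obtain ⟨h2, h3⟩ := (hmem _ _ _).1 h2
    exact hsW ⟨h2, (hmem _ _ _).2 ⟨h1, h3⟩⟩
  have hh : IsUnit (algebraMap A[X] (Localization.Away h) h) :=
    IsLocalization.Away.algebraMap_isUnit h
  let ρ₁ : Localization.Away (C s * X : A[X]) →ₐ[A[X]] Localization.Away h :=
    awayLift _ (isUnit_of_dvd_unit (map_dvd _ ⟨g, rfl⟩) hh)
  let ρ₀ : Localization.Away (C s * g : A[X]) →ₐ[A[X]] Localization.Away h :=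
    awayLift _ (isUnit_of_dvd_unit (map_dvd _ ⟨X, by ring⟩) hh)
  obtain ⟨b, c, hbc⟩ := exists_map_eq_add_map F hF' s g h rfl rfl ρ₁ ρ₀ (x.1 ⟨h, hhW⟩)
  have hh₁ : PrimeSpectrum.basicOpen h ≤ PrimeSpectrum.basicOpen (C s * X : A[X]) :=
    fun q hq => ((hmem _ _ _).1 hq).1
  have hh₀ : PrimeSpectrum.basicOpen h ≤ PrimeSpectrum.basicOpen (C s * g : A[X]) := fun q hq =>
    (hmem _ _ _).2 ⟨((hmem _ _ _).1 ((hmem _ _ _).1 hq).1).1, ((hmem _ _ _).1 hq).2⟩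
  have key : openSec.res F A[X] hh₁ (openSec.ofSec F _ b) =
      openSec.res F A[X] hhW x + openSec.res F A[X] hh₀ (openSec.ofSec F _ c) := by
    refine Subtype.ext (funext fun f => ?_)
    let φ : Localization.Away h →ₐ[A[X]] Localization.Away f.1 := awayLift h
      ((PrimeSpectrum.basicOpen_le_basicOpen_iff_algebraMap_isUnit
        (S := Localization.Away f.1)).1 f.2)
    have e := congrArg (Sec.map F (φ.restrictScalars k)) hbc
    rw [map_add, Sec.map_map_restrictScalars, Sec.map_map_restrictScalars] at e
    refine (openSec.ofSec_apply _ b ⟨f.1, f.2.trans hh₁⟩ (φ.comp ρ₁)).trans (e.trans ?_)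
    exact congrArg₂ (· + ·) (x.2 ⟨h, hhW⟩ ⟨f.1, f.2.trans hhW⟩ φ)
      (openSec.ofSec_apply _ c ⟨f.1, f.2.trans hh₀⟩ (φ.comp ρ₀)).symm
  let V' : Opens (PrimeSpectrum (LineRing A p)) := PrimeSpectrum.basicOpen (lineMap A p g)
  have hV'V : V' ≤ V := fun y hy => hg₀V fun h => hy <| by
    rw [hg, map_mul]
    exact Ideal.mul_mem_left _ _ h
  have hb : ∀ y ∈ puncture (⊤ : Opens (PrimeSpectrum (LineRing A p))),
      PrimeSpectrum.comap (lineMap A p) y ∈ PrimeSpectrum.basicOpen (C s * X : A[X]) :=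
    fun y hy => (hmem _ _ _).2 ⟨lineMap_C_notMem hsp y, fun h => hy.2 <| by
      have hX : lineMap A p X ∈ y.asIdeal := h
      rw [show lineMap A p X = X from map_X _] at hX
      exact Set.singleton_subset_iff.2 hX⟩
  have hc : ∀ y ∈ V', PrimeSpectrum.comap (lineMap A p) y ∈
      PrimeSpectrum.basicOpen (C s * g : A[X]) :=
    fun y hy => (hmem _ _ _).2 ⟨lineMap_C_notMem hsp y, hy⟩
  have hn : ∀ y ∈ puncture V ⊓ V', PrimeSpectrum.comap (lineMap A p) y ∈
      PrimeSpectrum.basicOpen h := fun y hy =>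
    (hmem _ _ _).2 ⟨hb y ⟨trivial, hy.1.2⟩, hy.2⟩
  let β := Germ.of F (lineMap A p) _ hb (openSec.ofSec F _ b)
  let γ := Germ.of F (lineMap A p) _ hc (openSec.ofSec F _ c)
  -- The relation b = x + c, which holds on D(h), says that b - x and c agree on (V - 0) ∩ V'. Their
  -- common extension δ to V shows that b - x is zero in the cokernel.
  obtain ⟨δ, hδ, -⟩ := Germ.exists_glue_lineMap hF
    (puncture_sup_eq (V' := V') (zeroSection_subset_basicOpen hsp)) (puncture_le V) hV'V
    (Germ.res F (lineMap A p) (puncture_mono le_top) β - Germ.of F (lineMap A p) W hW x) γ (by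
      have e := congrArg (Germ.of F (lineMap A p) _ hn) key
      rw [map_add, Germ.of_res F (lineMap A p) (V := puncture V ⊓ V')
          (fun y hy => hb y ⟨trivial, hy.1.2⟩),
        Germ.of_res F (lineMap A p) (V := puncture V ⊓ V')
          (fun y hy => hW y hy.1),
        Germ.of_res F (lineMap A p) (V := puncture V ⊓ V')
          (fun y hy => hc y hy.2)] at e
      rw [map_sub, Germ.res_res, Germ.res_of, Germ.res_of, Germ.res_of, e, add_sub_cancel_left])
  refine ⟨QuotientAddGroup.mk β, ?_⟩
  refine (QuotientAddGroup.eq (s := (Germ.res F (lineMap A p) (puncture_le V)).range)).2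
    ⟨-δ, ?_⟩
  rw [map_neg, hδ]
  abel

end Excision
end WittTransfers

theorem mainTheorem10 {k : Type u} [Field k] [PerfectField k] (hk : ringChar k ≠ 2)
    (F : (WittTransfers.WCor k)ᵒᵖ ⥤ AddCommGrpCat.{w}) [F.Additive]
    (hF : WittTransfers.IsZariskiSheaf F) (hF' : WittTransfers.IsHomotopyInvariant F)
    (A : Type u) [CommRing A] [Algebra k A] [Algebra.Smooth k A] (p : Ideal A) [p.IsPrime]
    (V : Opens (PrimeSpectrum (WittTransfers.LineRing A p)))
    (hV : WittTransfers.zeroSection A p ⊆ V) :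
    Function.Bijective (WittTransfers.PairSec.res F A p (le_top : V ≤ ⊤)) :=
  ⟨WittTransfers.PairSec.res_injective hF le_top hV,
    WittTransfers.PairSec.res_surjective hF hF' hV⟩
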